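/- **Theorem 5 (Asymptotic distribution).** Let $\mathbf X=\{(X_1(t),X_2(t))^\top,\ t\in\mathbb R\}$ be a centred stationary bivariate Gaussian process with covariance functions $C_{ij}(t)=\mathrm E[X_i(s)X_j(s+t)]$, $i,j\in\{1,2\}$, where $C_{12}=C_{21}$. Let $\alpha_{11},\alpha_{22}\in(0,2)$, $\sigma_1,\sigma_2>0$, $|\rho|\in(0,1)$, $c_{11},c_{22},c_{12}>0$, and suppose that either $\frac{\alpha_{11}+\alpha_{22}}2<\alpha_{12}$, or $\frac{\alpha_{11}+\alpha_{22}}2=\alpha_{12}$ and $c_{12}^2\rho^2\sigma_1^2\sigma_2^2<c_{11}c_{22}$. Assume: (A3) for some $\beta_{11},\beta_{22},\beta_{12}>0$, as $t\to0$, $C_{ii}(t)=\sigma_i^2-c_{ii}|t|^{\alpha_{ii}}+O(|t|^{\alpha_{ii}+\beta_{ii}})$ for $i=1,2$, and $C_{12}(t)=\rho\sigma_1\sigma_2\bigl(1-c_{12}|t|^{\alpha_{12}}+O(|t|^{\alpha_{12}+\beta_{12}})\bigr)$; (A2) the functions $C_{ij}$ are four times differentiable on $\{t:0<|t|<r\}$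 for some $r>1$, and, writing $(\alpha)_4=\alpha(\alpha-1)(\alpha-2)(\alpha-3)$, as $t\to0$, $t\ne0$: $C_{ii}^{(4)}(t)=-c_{ii}(\alpha_{ii})_4|t|^{\alpha_{ii}-4}+o(|t|^{\alpha_{ii}-4})$ for $i=1,2$, and $C_{12}^{(4)}(t)=C_{21}^{(4)}(t)=-\rho\sigma_1\sigma_2c_{12}(\alpha_{12})_4|t|^{\alpha_{12}-4}+o(|t|^{\alpha_{12}-4})$. Let $a_{-1}=a_1=1$, $a_0=-2$, let $m\ge2$ be an integer, and let $L_{u,i}$ ($1\le u\le m$, $i=1,2$) be real numbers with $\sum_uL_{u,i}=0$ and $\sum_uL_{u,i}\ln u=1$. Put $Y^u_{n,i}(j)=n^{\alpha_{ii}/2}\sum_{k=-1}^1a_kX_i\bigl(\frac{j+ku}n\bigr)$, $\bar Z^u_{n,i}=\frac1n\sum_{j=1}^n(Y^u_{n,i}(j))^2$ and $\hat\alpha_{ii}=\sum_{u=1}^mL_{u,i}\ln\bar Z^u_{n,i}$. For $h\in\mathbb Z$ let $$\sigma^{uv}_{0,ii}(h)=-c_{ii}\sum_{j,k=-1}^1a_ja_k|h+kv-ju|^{\alpha_{ii}},$$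 $$\sigma^{uv}_{0,12}(h)=\sigma^{uv}_{0,21}(h)=\begin{cases}0,&\frac{\alpha_{11}+\alpha_{22}}2<\alpha_{12},\\-\rho\sigma_1\sigma_2c_{12}\sum_{j,k=-1}^1a_ja_k|h+kv-ju|^{\alpha_{12}},&\frac{\alpha_{11}+\alpha_{22}}2=\alpha_{12}.\end{cases}$$ Let $\mathbf\Phi_{0,ij}$ be the $m\times m$ matrix with entries $2\sum_{h\in\mathbb Z}(\sigma^{uv}_{0,ij}(h))^2$, and let $\widetilde{\mathbf L}_i=(L_{1,i}/\tau_{1,i},\dots,L_{m,i}/\tau_{m,i})^\top$ with $\tau_{u,i}=c_{ii}(8-2^{\alpha_{ii}+1})u^{\alpha_{ii}}$. If $\beta_{11},\beta_{22}>1/2$, then the series defining $\mathbf\Phi_{0,ij}$ converge, the $2\times2$ matrix $\bigl(\widetilde{\mathbf L}_i^\top\mathbf\Phi_{0,ij}\widetilde{\mathbf L}_j\bigr)_{i,j=1,2}$ is positive semidefinite, and, as $n\to\infty$, $$\sqrt n\begin{pmatrix}\hat\alpha_{11}-\alpha_{11}\\\hat\alpha_{22}-\alpha_{22}\end{pmatrix}\xrightarrow{d}\mathcal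 N\left(\begin{pmatrix}0\\0\end{pmatrix},\begin{pmatrix}\widetilde{\mathbf L}_1^\top\mathbf\Phi_{0,11}\widetilde{\mathbf L}_1&\widetilde{\mathbf L}_1^\top\mathbf\Phi_{0,12}\widetilde{\mathbf L}_2\\\widetilde{\mathbf L}_2^\top\mathbf\Phi_{0,21}\widetilde{\mathbf L}_1&\widetilde{\mathbf L}_2^\top\mathbf\Phi_{0,22}\widetilde{\mathbf L}_2\end{pmatrix}\right).$$ In particular, if $\frac{\alpha_{11}+\alpha_{22}}2<\alpha_{12}$, then $\sqrt n\,\hat\alpha_{11}$ and $\sqrt n\,\hat\alpha_{22}$ are asymptotically independent, that is, after deterministic centring their joint law converges weakly to a product of two probability laws on $\mathbb R$. -/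

import Mathlib

open Filter Topology MeasureTheory ProbabilityTheory Asymptotics
open scoped Matrix

namespace BivariateFractal

/-- The scalar parameters of a bivariate covariance model near the origin. -/
structure Params where
  α₁₁ : ℝ
  α₂₂ : ℝ
  α₁₂ : ℝ
  σ₁ : ℝ
  σ₂ : ℝ
  ρ : ℝ
  c₁₁ : ℝ
  c₂₂ : ℝ
  c₁₂ : ℝ

/-- The ranges of the parameters. -/
structure Params.InRange (p : Params) : Prop where
  α₁₁_mem : p.α₁₁ ∈ Set.Ioo (0 : ℝ) 2
  α₂₂_mem : p.α₂₂ ∈ Set.Ioo (0 : ℝ) 2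
  σ₁_pos : 0 < p.σ₁
  σ₂_pos : 0 < p.σ₂
  abs_ρ_mem : |p.ρ| ∈ Set.Ioo (0 : ℝ) 1
  c₁₁_pos : 0 < p.c₁₁
  c₂₂_pos : 0 < p.c₂₂
  c₁₂_pos : 0 < p.c₁₂

/-- The compatibility restriction between the marginal and the cross parameters. -/
def Params.Compatible (p : Params) : Prop :=
  (p.α₁₁ + p.α₂₂) / 2 < p.α₁₂ ∨
    ((p.α₁₁ + p.α₂₂) / 2 = p.α₁₂ ∧
      p.c₁₂ ^ 2 * p.ρ ^ 2 * p.σ₁ ^ 2 * p.σ₂ ^ 2 < p.c₁₁ * p.c₂₂)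

/-- The fractal index `α_ii` of the `i`-th component. -/
def Params.α (p : Params) : Fin 2 → ℝ := ![p.α₁₁, p.α₂₂]

/-- The constant `c_ii` of the `i`-th component. -/
def Params.c (p : Params) : Fin 2 → ℝ := ![p.c₁₁, p.c₂₂]

section GaussianModel

variable {Ω : Type*} [MeasurableSpace Ω]

/-- `X = (X 0, X 1)` is a centred bivariate stationary Gaussian process on `ℝ` with matrix-valued
covariance function `C i j t = E[X i s * X j (s + t)]`. -/
structure IsStationaryGaussian (X : Fin 2 → ℝ → Ω → ℝ) (C : Fin 2 → Fin 2 → ℝ → ℝ)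
    (P : Measure Ω) : Prop where
  gaussian : IsGaussianProcess (fun q : Fin 2 × ℝ => X q.1 q.2) P
  centred : ∀ i t, ∫ ω, X i t ω ∂P = 0
  covariance : ∀ i j s t, ∫ ω, X i s ω * X j (s + t) ω ∂P = C i j t

end GaussianModel

/-- `α! / (α - 4)! = α (α - 1) (α - 2) (α - 3)`. -/
def fallingFour (α : ℝ) : ℝ := α * (α - 1) * (α - 2) * (α - 3)

/-- The condition on the fourth derivatives: each `C i j` is four times differentiable at all
nonzero lags of the observation window `[-1, 1]` (and slightly beyond), and the fourth derivatives
have the prescribed behaviour at the origin. -/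
structure CondA2 (p : Params) (C : Fin 2 → Fin 2 → ℝ → ℝ) : Prop where
  differentiable : ∃ r : ℝ, 1 < r ∧ ∀ i j : Fin 2, ∀ k < 4, ∀ t : ℝ, 0 < |t| → |t| < r →
    DifferentiableAt ℝ (iteratedDeriv k (C i j)) t
  fourth₁₁ : (fun t : ℝ => iteratedDeriv 4 (C 0 0) t
      - (-(p.c₁₁ * fallingFour p.α₁₁) * |t| ^ (p.α₁₁ - 4))) =o[𝓝[≠] 0]
    fun t : ℝ => |t| ^ (p.α₁₁ - 4)
  fourth₂₂ : (fun t : ℝ => iteratedDeriv 4 (C 1 1) t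
      - (-(p.c₂₂ * fallingFour p.α₂₂) * |t| ^ (p.α₂₂ - 4))) =o[𝓝[≠] 0]
    fun t : ℝ => |t| ^ (p.α₂₂ - 4)
  fourth₁₂ : (fun t : ℝ => iteratedDeriv 4 (C 0 1) t
      - (-(p.ρ * p.σ₁ * p.σ₂ * (p.c₁₂ * fallingFour p.α₁₂)) * |t| ^ (p.α₁₂ - 4))) =o[𝓝[≠] 0]
    fun t : ℝ => |t| ^ (p.α₁₂ - 4)
  fourth_symm : ∀ t : ℝ, t ≠ 0 → iteratedDeriv 4 (C 0 1) t = iteratedDeriv 4 (C 1 0) t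

/-- The expansion of the covariance function at the origin with remainder exponents
`β₁₁, β₂₂, β₁₂`, together with the parameter ranges and the compatibility restriction. -/
structure CondA3 (p : Params) (β₁₁ β₂₂ β₁₂ : ℝ) (C : Fin 2 → Fin 2 → ℝ → ℝ) : Prop where
  inRange : p.InRange
  compatible : p.Compatible
  β₁₁_pos : 0 < β₁₁
  β₂₂_pos : 0 < β₂₂
  β₁₂_pos : 0 < β₁₂
  expansion₁₁ : (fun t : ℝ => C 0 0 t - (p.σ₁ ^ 2 - p.c₁₁ * |t| ^ p.α₁₁)) =O[𝓝 0]
    fun t : ℝ => |t| ^ (p.α₁₁ + β₁₁)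
  expansion₂₂ : (fun t : ℝ => C 1 1 t - (p.σ₂ ^ 2 - p.c₂₂ * |t| ^ p.α₂₂)) =O[𝓝 0]
    fun t : ℝ => |t| ^ (p.α₂₂ + β₂₂)
  expansion₁₂ : (fun t : ℝ => C 0 1 t - p.ρ * p.σ₁ * p.σ₂ * (1 - p.c₁₂ * |t| ^ p.α₁₂)) =O[𝓝 0]
    fun t : ℝ => |t| ^ (p.α₁₂ + β₁₂)
  symm : ∀ t : ℝ, C 0 1 t = C 1 0 t

/-- The second-difference filter `a₋₁ = 1, a₀ = -2, a₁ = 1`. -/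
def filterCoeff (k : ℤ) : ℝ := if k = 0 then -2 else 1

section Estimator

variable {Ω : Type*}

/-- The dilated filtered discretized process
`Y_{n,i}^u(j) = n ^ (α_ii / 2) * ∑_{k = -1}^{1} a_k X_i((j + k u) / n)`. -/
noncomputable def Y (p : Params) (X : Fin 2 → ℝ → Ω → ℝ) (i : Fin 2) (u n j : ℕ) (ω : Ω) : ℝ :=
  (n : ℝ) ^ (p.α i / 2) *
    ∑ k ∈ Finset.Icc (-1 : ℤ) 1, filterCoeff k * X i (((j : ℝ) + (k : ℝ) * (u : ℝ)) / (n : ℝ)) ω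

/-- The average of the squares, `(1 / n) * ∑_{j = 1}^{n} (Y_{n,i}^u(j)) ^ 2`. -/
noncomputable def Zbar (p : Params) (X : Fin 2 → ℝ → Ω → ℝ) (i : Fin 2) (u n : ℕ) (ω : Ω) : ℝ :=
  (1 / (n : ℝ)) * ∑ j ∈ Finset.Icc 1 n, (Y p X i u n j ω) ^ 2

/-- The dilation `u ∈ {1, …, m}` with index `u - 1` in `Fin m`. -/
def dilation {m : ℕ} (u : Fin m) : ℕ := (u : ℕ) + 1

/-- The estimator of `α_ii` with weights `L_{u,i}`. -/
noncomputable def alphaHat {m : ℕ} (p : Params) (L : Fin 2 → Fin m → ℝ) (X : Fin 2 → ℝ → Ω → ℝ)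
    (i : Fin 2) (n : ℕ) (ω : Ω) : ℝ :=
  ∑ u : Fin m, L i u * Real.log (Zbar p X i (dilation u) n ω)

end Estimator

/-- The conditions `∑_u L_{u,i} = 0` and `∑_u L_{u,i} log u = 1` for `i = 1, 2`. -/
def IsWeight {m : ℕ} (L : Fin 2 → Fin m → ℝ) : Prop :=
  ∀ i, ∑ u, L i u = 0 ∧ ∑ u, L i u * Real.log (dilation u : ℝ) = 1

/-- `∑_{j,k = -1}^{1} a_j a_k |h + k v - j u| ^ α`. -/
noncomputable def filteredPower (α : ℝ) (u v : ℕ) (h : ℤ) : ℝ :=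
  ∑ j ∈ Finset.Icc (-1 : ℤ) 1, ∑ k ∈ Finset.Icc (-1 : ℤ) 1,
    filterCoeff j * filterCoeff k *
      |(h : ℝ) + (k : ℝ) * (v : ℝ) - (j : ℝ) * (u : ℝ)| ^ α

/-- The limiting covariances `σ_{0,ij}^{uv}(h)`; the cross term does not depend on the order of
the two components because `C₁₂ = C₂₁`. -/
noncomputable def sigma0 (p : Params) (i j : Fin 2) (u v : ℕ) (h : ℤ) : ℝ :=
  if i = j then -(p.c i) * filteredPower (p.α i) u v h
  else if (p.α₁₁ + p.α₂₂) / 2 < p.α₁₂ then 0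
  else -(p.ρ * p.σ₁ * p.σ₂ * p.c₁₂) * filteredPower p.α₁₂ u v h

/-- The `m × m` matrix `Φ_{0,ij}`, with entries `2 ∑_{h ∈ ℤ} (σ_{0,ij}^{uv}(h)) ^ 2`. -/
noncomputable def Phi0 (p : Params) (m : ℕ) (i j : Fin 2) : Matrix (Fin m) (Fin m) ℝ :=
  Matrix.of fun u v => 2 * ∑' h : ℤ, (sigma0 p i j (dilation u) (dilation v) h) ^ 2

/-- `τ_{u,i} = c_ii (8 - 2 ^ (α_ii + 1)) u ^ α_ii`. -/
noncomputable def tau (p : Params) (i : Fin 2) (u : ℕ) : ℝ :=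
  p.c i * (8 - (2 : ℝ) ^ (p.α i + 1)) * (u : ℝ) ^ p.α i

/-- The vector `L̃_i = (L_{1,i} / τ_{1,i}, …, L_{m,i} / τ_{m,i})`. -/
noncomputable def Ltilde {m : ℕ} (p : Params) (L : Fin 2 → Fin m → ℝ) (i : Fin 2) : Fin m → ℝ :=
  fun u => L i u / tau p i (dilation u)

/-- The `2 × 2` matrix with entries `L̃_iᵀ Φ_{0,ij} L̃_j`. -/
noncomputable def limitCov {m : ℕ} (p : Params) (L : Fin 2 → Fin m → ℝ) :
    Matrix (Fin 2) (Fin 2) ℝ :=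
  Matrix.of fun i j => Ltilde p L i ⬝ᵥ (Phi0 p m i j *ᵥ Ltilde p L j)

/-- Two sequences of real random variables are asymptotically independent if, after a deterministic
centring of each, their joint law converges weakly to a product of two probability laws. -/
def AsymptoticallyIndependent {Ω : Type*} [MeasurableSpace Ω] (A B : ℕ → Ω → ℝ) (P : Measure Ω)
    [IsProbabilityMeasure P] : Prop :=
  ∃ (a b : ℕ → ℝ) (ν₁ ν₂ : ProbabilityMeasure ℝ),
    TendstoInDistribution (fun n ω => (A n ω - a n, B n ω - b n)) atTop
      (id : ℝ × ℝ → ℝ × ℝ) (fun _ => P) ((ν₁ : Measure ℝ).prod (ν₂ : Measure ℝ))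

end BivariateFractal

/-! After rescaling, each `Zbar` averages squares of a jointly stationary Gaussian array whose
lag-`h` covariance, `lagCov`, tends to `sigma0`. Filtering both arguments by a second difference
makes this covariance a fourth-order difference of `C i j` near `h / n`, so it is at most a constant
times `(1 + |h|) ^ (a - 3)`, with `a = (α_ii + α_jj) / 2 < 2`, for all `|h| < n` once `n` is large
(`exists_scaledCov_bound`). This is summable in `h`: the array has short memory, even when the
original process is rough, and a central limit theorem at rate `√n` follows.

The limit theorem is proved by diagonalization. A linear combination of the centred `√n * Zbar` has
the form `∑ d_a (Y_a ^ 2 - S_aa)` with `Y` Gaussian of covariance `S` and `d` of order `n ^ (-1/2)`.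
Writing `Y = B g` with `g` standard and `Bᵀ D B` diagonal turns it into `∑ l_k (g_k ^ 2 - 1)` with
independent terms, where `∑ l_k ^ 2 = ∑ d_a d_b S_ab ^ 2` converges and every `|l_k|` is at most an
absolute row sum of `D S`, hence tends to zero uniformly. As `E exp(i s (g ^ 2 - 1)) = exp(-s ^ 2) +
o(s ^ 2)`, the characteristic function is close to `exp(-∑ l_k ^ 2)`
(`exists_charFun_weighted_sum_sq_bound`, `tendsto_charFun_quadStat`).

The estimator is a linear combination of logarithms, linearized around `tau` in probability
(`tendstoInMeasure_log_sub_linear`). The exponents `β_ii > 1/2` make the bias `E Zbar - tau` of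
smaller order than `n ^ (-1/2)`, and the two conditions on the weights reduce `∑ L log tau` to
`α_ii`. Slutsky's theorem transfers the limit to the estimators. Positive semidefiniteness holds
because the quadratic form of the limit matrix is a limit of second moments. When the cross exponent
exceeds the mean of the marginal ones, the cross covariances vanish in the limit, so the Gaussian
limit has independent coordinates. -/

namespace BivariateFractal

/-! ### Diagonalization of a weighted sum of squares -/

section LinearAlgebra

open scoped MatrixOrder

variable {ι : Type*} [Fintype ι] [DecidableEq ι]

/-- A covariance matrix has a square root that diagonalizes a given weighted sum of squares. -/
lemma exists_factor_diagonalizing {S : Matrix ι ι ℝ} (hS : S.PosSemidef) (d : ι → ℝ) :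
    ∃ (B : Matrix ι ι ℝ) (l : ι → ℝ),
      B * Bᵀ = S ∧ Bᵀ * Matrix.diagonal d * B = Matrix.diagonal l := by
  obtain ⟨A, hA⟩ : ∃ A : Matrix ι ι ℝ, S = Aᵀ * A := by
    refine ⟨CFC.sqrt S, ?_⟩
    have h : (CFC.sqrt S)ᵀ = CFC.sqrt S := by
      rw [← Matrix.conjTranspose_eq_transpose_of_trivial]
      exact (CFC.sqrt_nonneg S).isSelfAdjoint
    rw [h, CFC.sqrt_mul_sqrt_self _ hS.nonneg]
  -- With `S = Aᵀ A`, any orthogonal `U` gives a factor `B = Aᵀ U` of `S`; taking `U` to diagonalize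
  -- the symmetric matrix `A D Aᵀ` makes `Bᵀ D B` diagonal.
  have hM : (A * Matrix.diagonal d * Aᵀ).IsHermitian := by
    rw [Matrix.IsHermitian, Matrix.conjTranspose_eq_transpose_of_trivial]
    simp [Matrix.transpose_mul, Matrix.mul_assoc]
  set U : Matrix ι ι ℝ := (hM.eigenvectorUnitary : Matrix ι ι ℝ) with hU
  have hUs : star U = Uᵀ := Matrix.conjTranspose_eq_transpose_of_trivial U
  have h1 : U * Uᵀ = 1 := by
    rw [← hUs]; exact Unitary.mul_star_self_of_mem hM.eigenvectorUnitary.2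
  have h2 : Uᵀ * U = 1 := by
    rw [← hUs]; exact Unitary.star_mul_self_of_mem hM.eigenvectorUnitary.2
  refine ⟨Aᵀ * U, hM.eigenvalues, ?_, ?_⟩
  · rw [Matrix.transpose_mul, Matrix.transpose_transpose, Matrix.mul_assoc, ← Matrix.mul_assoc U,
      h1, Matrix.one_mul, hA]
  · have h3 := hM.spectral_theorem
    rw [Unitary.conjStarAlgAut_apply] at h3
    have h4 : (RCLike.ofReal ∘ hM.eigenvalues : ι → ℝ) = hM.eigenvalues := by ext; simp
    rw [h4] at h3
    have h5 : A * Matrix.diagonal d * Aᵀ = U * Matrix.diagonal hM.eigenvalues * Uᵀ := by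
      rw [← hUs]; exact h3
    calc (Aᵀ * U)ᵀ * Matrix.diagonal d * (Aᵀ * U)
        = Uᵀ * (A * Matrix.diagonal d * Aᵀ) * U := by
          simp only [Matrix.transpose_mul, Matrix.transpose_transpose, Matrix.mul_assoc]
      _ = (Uᵀ * U) * Matrix.diagonal hM.eigenvalues * (Uᵀ * U) :=
          (congrArg (fun N => Uᵀ * N * U) h5).trans (by simp only [Matrix.mul_assoc])
      _ = _ := by rw [h2, Matrix.one_mul, Matrix.mul_one]

variable {S B : Matrix ι ι ℝ} {d l : ι → ℝ}

lemma sum_eigenvalues_eq (hB : B * Bᵀ = S)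
    (hl : Bᵀ * Matrix.diagonal d * B = Matrix.diagonal l) : ∑ k, l k = ∑ a, d a * S a a := by
  rw [← Matrix.trace_diagonal, ← hl, Matrix.mul_assoc, Matrix.trace_mul_comm, Matrix.mul_assoc, hB]
  simp [Matrix.trace, Matrix.diagonal_mul]

/-- By cyclicity of the trace, `tr ((Bᵀ D B) ^ 2) = tr ((D S) ^ 2)`. This sum is half the variance
of the quadratic form. -/
lemma sum_sq_eigenvalues_eq (hB : B * Bᵀ = S)
    (hl : Bᵀ * Matrix.diagonal d * B = Matrix.diagonal l) :
    ∑ k, l k ^ 2 = ∑ a, ∑ b, d a * d b * S a b ^ 2 := by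
  have hSs : Sᵀ = S := by rw [← hB]; simp
  have h1 : ∑ k, l k ^ 2 = Matrix.trace (Matrix.diagonal l * Matrix.diagonal l) := by
    rw [Matrix.diagonal_mul_diagonal, Matrix.trace_diagonal]
    simp [sq]
  have h2 : Matrix.trace (Matrix.diagonal l * Matrix.diagonal l)
      = Matrix.trace ((Matrix.diagonal d * S) * (Matrix.diagonal d * S)) := by
    rw [← hl, ← hB]
    simp only [Matrix.mul_assoc]
    rw [Matrix.trace_mul_comm]
    simp only [Matrix.mul_assoc]
  rw [h1, h2, Matrix.trace]
  refine Finset.sum_congr rfl fun a _ => ?_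
  rw [Matrix.diag_apply, Matrix.mul_apply]
  refine Finset.sum_congr rfl fun b _ => ?_
  rw [Matrix.diagonal_mul, Matrix.diagonal_mul, ← Matrix.transpose_apply S, hSs]
  ring

/-- Column `k` of `D B` satisfies `(D S) w = l k • w`, so evaluating at an entry of `w` of maximal
modulus bounds `l k` by a row sum. If that column is zero, `l k` itself is zero. -/
lemma abs_eigenvalue_le_of_row_sum_le (hB : B * Bᵀ = S)
    (hl : Bᵀ * Matrix.diagonal d * B = Matrix.diagonal l) {R : ℝ}
    (hR : ∀ a, ∑ b, |d a * S a b| ≤ R) (k : ι) : |l k| ≤ R := by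
  have hR0 : 0 ≤ R := (Finset.sum_nonneg fun _ _ => abs_nonneg _).trans (hR k)
  set w : ι → ℝ := fun a => (Matrix.diagonal d * B) a k with hw
  have hw1 : ∀ a, ∑ b, d a * S a b * w b = l k * w a := by
    intro a
    have : (Matrix.diagonal d * S) * (Matrix.diagonal d * B)
        = (Matrix.diagonal d * B) * Matrix.diagonal l := by
      rw [← hl, ← hB]; simp only [Matrix.mul_assoc]
    have h := congrFun (congrFun this a) k
    rw [Matrix.mul_apply, Matrix.mul_diagonal] at h
    simp only [Matrix.diagonal_mul d S] at h
    rw [h, mul_comm]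
  obtain ⟨a, -, ha⟩ := Finset.exists_max_image Finset.univ (fun a => |w a|) ⟨k, Finset.mem_univ k⟩
  rcases eq_or_ne (w a) 0 with h0 | h0
  · have hw0 : ∀ b, w b = 0 := fun b => by
      have := ha b (Finset.mem_univ b)
      rw [h0, abs_zero] at this
      exact abs_nonpos_iff.1 this
    have h := congrFun (congrFun hl k) k
    rw [Matrix.mul_assoc, Matrix.mul_apply, Matrix.diagonal_apply_eq] at h
    rw [← h, Finset.sum_eq_zero fun b _ => by rw [show (Matrix.diagonal d * B) b k = 0 from hw0 b,
      mul_zero], abs_zero]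
    exact hR0
  · have hpos : 0 < |w a| := abs_pos.2 h0
    refine le_of_mul_le_mul_right ?_ hpos
    calc |l k| * |w a| = |∑ b, d a * S a b * w b| := by rw [hw1 a, abs_mul]
      _ ≤ ∑ b, |d a * S a b * w b| := Finset.abs_sum_le_sum_abs _ _
      _ ≤ ∑ b, |d a * S a b| * |w a| := Finset.sum_le_sum fun b _ => by
          rw [abs_mul]
          exact mul_le_mul_of_nonneg_left (ha b (Finset.mem_univ b)) (abs_nonneg _)
      _ = (∑ b, |d a * S a b|) * |w a| := by rw [Finset.sum_mul]
      _ ≤ R * |w a| := mul_le_mul_of_nonneg_right (hR a) (abs_nonneg _)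

/-- The weighted sum of squares in diagonalized coordinates. -/
lemma sum_mul_sq_mulVec (hl : Bᵀ * Matrix.diagonal d * B = Matrix.diagonal l) (x : ι → ℝ) :
    ∑ a, d a * (B *ᵥ x) a ^ 2 = ∑ k, l k * x k ^ 2 := by
  have h1 : ∑ a, d a * (B *ᵥ x) a ^ 2 = (B *ᵥ x) ⬝ᵥ (Matrix.diagonal d *ᵥ (B *ᵥ x)) := by
    simp only [dotProduct, Matrix.mulVec_diagonal]
    exact Finset.sum_congr rfl fun a _ => by ring
  have h2 : ∑ k, l k * x k ^ 2 = x ⬝ᵥ (Matrix.diagonal l *ᵥ x) := by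
    simp only [dotProduct, Matrix.mulVec_diagonal]
    exact Finset.sum_congr rfl fun a _ => by ring
  rw [h1, h2, ← hl, ← Matrix.mulVec_mulVec, ← Matrix.mulVec_mulVec, Matrix.dotProduct_mulVec x,
    Matrix.vecMul_transpose]

end LinearAlgebra

/-! ### Moments and characteristic function of a centred chi-square variable -/

section ChiSquare

lemma integral_pow_four_gaussianReal : ∫ x, x ^ 4 ∂(gaussianReal 0 1) = 3 := by
  have h0 : ∫ x, x ^ 4 ∂(gaussianReal 0 1)
      = iteratedDeriv 4 (mgf (fun x ↦ x) (gaussianReal 0 1)) 0 := by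
    rw [iteratedDeriv_mgf_zero] <;> simp
  -- Differentiating `q * exp (t ^ 2 / 2)` replaces `q` by `q' + t * q`; four rounds starting from
  -- `1` leave a polynomial with value `3` at the origin.
  have hd : ∀ (q q' : ℝ → ℝ), (∀ t, HasDerivAt q (q' t) t) →
      deriv (fun t => q t * Real.exp (t ^ 2 / 2))
        = fun t => (q' t + t * q t) * Real.exp (t ^ 2 / 2) := by
    intro q q' hq
    ext t
    have h1 : HasDerivAt (fun t : ℝ => t ^ 2 / 2) t t := by
      have := (hasDerivAt_pow 2 t).div_const 2
      convert! this using 1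
      simp
    have := ((hq t).mul h1.exp).deriv
    rw [show (fun t => q t * Real.exp (t ^ 2 / 2)) = q * fun t => Real.exp (t ^ 2 / 2) from rfl,
      this]
    ring
  have e0 : mgf (fun x ↦ x) (gaussianReal 0 1) = fun t => 1 * Real.exp (t ^ 2 / 2) := by
    rw [mgf_fun_id_gaussianReal]; ext t; simp
  have e1 := hd (fun _ => 1) (fun _ => 0) fun t => hasDerivAt_const t 1
  have e2 := hd (fun t => 0 + t * 1) (fun _ => 1) fun t => by
    simpa using hasDerivAt_id' t
  have e3 := hd (fun t => 1 + t * (0 + t * 1)) (fun t => 2 * t) fun t => by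
    simpa [sq] using (hasDerivAt_pow 2 t).const_add 1
  have e4 := hd (fun t => 2 * t + t * (1 + t * (0 + t * 1))) (fun t => 3 + 3 * t ^ 2) fun t => by
    have h := ((hasDerivAt_id t).const_mul 3).add (hasDerivAt_pow 3 t)
    convert! h using 1
    · ext s; simp; ring
    · simp
  rw [h0, e0, iteratedDeriv_succ', e1, iteratedDeriv_succ', e2, iteratedDeriv_succ', e3,
    iteratedDeriv_succ', e4]
  simp

lemma integrable_pow_gaussianReal (k : ℕ) : Integrable (fun x : ℝ => x ^ k) (gaussianReal 0 1) := by
  have := (memLp_id_gaussianReal (μ := 0) (v := 1) k).integrable_norm_pow'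
  refine (integrable_norm_iff (by fun_prop)).1 ?_
  simpa using this

lemma integral_sq_gaussianReal : ∫ x, x ^ 2 ∂(gaussianReal 0 1) = 1 := by
  have h := variance_eq_integral (μ := gaussianReal 0 1) (X := fun x => x) (by fun_prop)
  rw [variance_fun_id_gaussianReal] at h
  simpa using h.symm

lemma integral_sq_sub_one_gaussianReal : ∫ x, (x ^ 2 - 1) ∂(gaussianReal 0 1) = 0 := by
  rw [integral_sub (integrable_pow_gaussianReal 2) (integrable_const _), integral_sq_gaussianReal]
  simp

lemma integral_sq_sub_one_sq_gaussianReal : ∫ x, (x ^ 2 - 1) ^ 2 ∂(gaussianReal 0 1) = 2 := by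
  have h : ∀ x : ℝ, (x ^ 2 - 1) ^ 2 = x ^ 4 - 2 * x ^ 2 + 1 := fun x => by ring
  simp_rw [h]
  rw [integral_add (by
      exact (integrable_pow_gaussianReal 4).sub ((integrable_pow_gaussianReal 2).const_mul 2))
      (integrable_const _),
    integral_sub (integrable_pow_gaussianReal 4) ((integrable_pow_gaussianReal 2).const_mul 2),
    integral_const_mul, integral_sq_gaussianReal, integral_pow_four_gaussianReal]
  norm_num

lemma memLp_sq_sub_one_gaussianReal : MemLp (fun x : ℝ => x ^ 2 - 1) 2 (gaussianReal 0 1) :=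
  (memLp_two_iff_integrable_sq (by fun_prop)).2 <| .of_integral_ne_zero <| by
    rw [integral_sq_sub_one_sq_gaussianReal]; norm_num

/-- Second order expansion of the characteristic function of a centred `χ²` variable. -/
lemma charFun_sq_sub_one_isLittleO :
    (fun s : ℝ => (∫ x : ℝ, Complex.exp (((s * (x ^ 2 - 1) : ℝ) : ℂ) * Complex.I)
      ∂(gaussianReal 0 1)) - Complex.exp (-((s ^ 2 : ℝ) : ℂ))) =o[𝓝 0] fun s => s ^ 2 := by
  -- Since `x ^ 2 - 1` has variance `2`, dividing by `√2` gives unit variance; the expansion of the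
  -- characteristic function of `Z` is then read at `√2 * s`.
  set Z : ℝ → ℝ := fun x => (√2)⁻¹ * (x ^ 2 - 1) with hZ
  have hZm : AEMeasurable Z (gaussianReal 0 1) := by fun_prop
  have h0 : (gaussianReal 0 1)[Z] = 0 := by
    rw [hZ, integral_const_mul, integral_sq_sub_one_gaussianReal, mul_zero]
  have h1 : (gaussianReal 0 1)[Z ^ 2] = 1 := by
    simp only [hZ, Pi.pow_apply, mul_pow, inv_pow]
    rw [integral_const_mul, integral_sq_sub_one_sq_gaussianReal]
    norm_num
  have h2 := taylor_charFun_two hZm h0 h1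
  have hc : Tendsto (fun s : ℝ => √2 * s) (𝓝 0) (𝓝 0) := by
    have : Continuous fun s : ℝ => √2 * s := by fun_prop
    simpa using this.tendsto 0
  have h3 := h2.comp_tendsto hc
  have h4 : (fun s : ℝ => (∫ x : ℝ, Complex.exp (((s * (x ^ 2 - 1) : ℝ) : ℂ) * Complex.I)
      ∂(gaussianReal 0 1)) - (1 - (s : ℂ) ^ 2)) =o[𝓝 0] fun s => s ^ 2 := by
    have h5 : ((fun t : ℝ => t ^ 2) ∘ fun s : ℝ => √2 * s) = fun s => 2 * s ^ 2 := by
      ext s; simp [mul_pow]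
    rw [h5] at h3
    refine (h3.congr_left fun s => ?_).trans_isBigO (isBigO_const_mul_self 2 _ _)
    simp only [Function.comp]
    rw [charFun_apply_real, integral_map hZm (by fun_prop)]
    congr 1
    · refine integral_congr_ae (Eventually.of_forall fun x => ?_)
      simp only [hZ]
      congr 2
      push_cast
      have : ((√2 : ℝ) : ℂ) ≠ 0 := by simp
      field_simp
    · push_cast
      rw [mul_pow, ← Complex.ofReal_pow, Real.sq_sqrt (by norm_num)]
      push_cast; ring
  have h6 : (fun s : ℝ => (1 - (s : ℂ) ^ 2) - Complex.exp (-((s ^ 2 : ℝ) : ℂ)))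
      =o[𝓝 0] fun s : ℝ => s ^ 2 := by
    have hO : (fun s : ℝ => (1 - (s : ℂ) ^ 2) - Complex.exp (-((s ^ 2 : ℝ) : ℂ)))
        =O[𝓝 0] fun s : ℝ => s ^ 4 := by
      refine IsBigO.of_bound 1 ?_
      filter_upwards [Metric.ball_mem_nhds (0 : ℝ) one_pos] with s hs
      rw [Metric.mem_ball, dist_zero_right, Real.norm_eq_abs] at hs
      have hn : ‖-((s ^ 2 : ℝ) : ℂ)‖ ≤ 1 := by
        rw [norm_neg, Complex.norm_real, Real.norm_eq_abs, abs_pow]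
        exact pow_le_one₀ (abs_nonneg _) hs.le
      have := Complex.norm_exp_sub_one_sub_id_le hn
      rw [norm_neg, Complex.norm_real] at this
      rw [one_mul, ← norm_neg]
      refine le_trans (le_of_eq ?_) (this.trans (le_of_eq ?_))
      · congr 1; push_cast; ring
      · rw [norm_pow, norm_pow, ← pow_mul]
    exact hO.trans_isLittleO (isLittleO_pow_pow (by norm_num))
  refine (h4.add h6).congr_left fun s => ?_
  ring

end ChiSquare

/-! ### Centred Gaussian vectors as linear images of standard ones -/

section GaussianVector

variable {ι : Type*} [Fintype ι]

/-- The second moment matrix of a random vector is positive semidefinite. -/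
lemma posSemidef_of_integral_mul {Ω : Type*} [MeasurableSpace Ω] {P : Measure Ω}
    {Y : ι → Ω → ℝ} (hY : ∀ a, MemLp (Y a) 2 P) {S : Matrix ι ι ℝ}
    (hS : ∀ a b, ∫ ω, Y a ω * Y b ω ∂P = S a b) : S.PosSemidef := by
  refine Matrix.PosSemidef.of_dotProduct_mulVec_nonneg ?_ fun x => ?_
  · rw [Matrix.IsHermitian, Matrix.conjTranspose_eq_transpose_of_trivial]
    ext a b
    rw [Matrix.transpose_apply, ← hS, ← hS]
    simp_rw [mul_comm]
  · have h : star x ⬝ᵥ S *ᵥ x = ∫ ω, (∑ a, x a * Y a ω) ^ 2 ∂P := by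
      have hi : ∀ a b, Integrable (fun ω => (x a * Y a ω) * (x b * Y b ω)) P := fun a b => by
        have := ((hY a).integrable_mul (hY b)).const_mul (x a * x b)
        refine this.congr (Eventually.of_forall fun ω => ?_)
        simp only [Pi.mul_apply]; ring
      simp_rw [sq, Finset.sum_mul_sum]
      rw [integral_finsetSum _ fun a _ => integrable_finsetSum _ fun b _ => hi a b]
      simp only [dotProduct, Matrix.mulVec, Finset.mul_sum, Pi.star_apply, star_trivial]
      refine Finset.sum_congr rfl fun a _ => ?_
      rw [integral_finsetSum _ fun b _ => hi a b]
      refine Finset.sum_congr rfl fun b _ => ?_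
      rw [← hS, ← mul_assoc, mul_right_comm, ← integral_const_mul]
      refine integral_congr_ae (Eventually.of_forall fun ω => ?_)
      ring
    rw [h]
    exact integral_nonneg fun ω => sq_nonneg _

lemma map_mulVec_stdGaussian [DecidableEq ι] {S B : Matrix ι ι ℝ} (hS : S.PosSemidef) (hB : B * Bᵀ = S) :
    (stdGaussian (EuclideanSpace ℝ ι)).map (Matrix.toEuclideanCLM (𝕜 := ℝ) B)
      = multivariateGaussian 0 S := by
  apply IsGaussian.ext
  · simp only [id_eq]
    rw [ContinuousLinearMap.integral_id_map IsGaussian.integrable_id, integral_id_stdGaussian,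
      integral_id_multivariateGaussian, map_zero]
  · ext x y
    rw [covarianceBilin_map IsGaussian.memLp_two_id, covarianceBilin_stdGaussian,
      covarianceBilin_multivariateGaussian hS, innerSL_apply_apply,
      ContinuousLinearMap.adjoint_inner_left, ← ContinuousLinearMap.star_eq_adjoint, ← map_star,
      ← mul_apply_eq_comp, ← map_mul, Matrix.inner_toEuclideanCLM, Matrix.star_eq_conjTranspose,
      Matrix.conjTranspose_eq_transpose_of_trivial, hB]

/-- A centred Gaussian vector with covariance `B Bᵀ` is distributed as `B g`, with `g` standard. -/
lemma map_gaussianVector_eq {Ω : Type*} [MeasurableSpace Ω] {P : Measure Ω}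
    {Y : ι → Ω → ℝ} (hY : HasGaussianLaw (fun ω a => Y a ω) P) (h0 : ∀ a, ∫ ω, Y a ω ∂P = 0)
    {S B : Matrix ι ι ℝ} (hS : ∀ a b, ∫ ω, Y a ω * Y b ω ∂P = S a b) (hB : B * Bᵀ = S) :
    P.map (fun ω a => Y a ω)
      = (Measure.pi fun _ : ι => gaussianReal 0 1).map fun x => B *ᵥ x := by
  classical
  have hYm : AEMeasurable (fun ω a => Y a ω) P := hY.aemeasurable
  have := hY.isProbabilityMeasure
  have hL2 : ∀ a, MemLp (Y a) 2 P := fun a => (hY.eval a).memLp_two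
  have hpsd := posSemidef_of_integral_mul hL2 hS
  have hG := hY.toLp_pi 2
  have := hG.isGaussian_map
  have hE : P.map (fun ω => WithLp.toLp 2 fun a => Y a ω) = multivariateGaussian 0 S := by
    have hm : AEMeasurable (fun ω => WithLp.toLp 2 fun a => Y a ω) P := hG.aemeasurable
    apply IsGaussian.ext
    · rw [integral_id_multivariateGaussian', integral_map hm (by fun_prop)]
      ext a
      have h := (EuclideanSpace.proj (𝕜 := ℝ) a : EuclideanSpace ℝ ι →L[ℝ] ℝ).integral_comp_comm
        hG.integrable
      simp only [id, PiLp.zero_apply]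
      simp only [EuclideanSpace.coe_proj] at h
      rw [← h]
      exact h0 a
    · rw [← ContinuousLinearMap.toBilinForm_inj]
      refine LinearMap.BilinForm.ext_basis (EuclideanSpace.basisFun ι ℝ).toBasis fun a b ↦ ?_
      rw [ContinuousLinearMap.toBilinForm_apply, ContinuousLinearMap.toBilinForm_apply,
        covarianceBilin_apply_eq_cov IsGaussian.memLp_two_id,
        covarianceBilin_multivariateGaussian hpsd, covariance_map (by fun_prop) (by fun_prop) hm]
      have (a : ι) : (fun u ↦ inner ℝ ((EuclideanSpace.basisFun ι ℝ).toBasis a) u) ∘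
          (fun ω => WithLp.toLp 2 fun a => Y a ω) = Y a := by
        ext; simp [PiLp.inner_apply]
      rw [this, this, covariance_eq_sub (hL2 a) (hL2 b), h0 a, zero_mul, sub_zero]
      simp [← hS]
  have h1 : (P.map fun ω => WithLp.toLp 2 fun a => Y a ω).map WithLp.ofLp
      = P.map (fun ω a => Y a ω) := by
    rw [AEMeasurable.map_map_of_aemeasurable (by fun_prop) hG.aemeasurable]; rfl
  rw [← h1, hE, ← map_mulVec_stdGaussian hpsd hB, ← map_pi_eq_stdGaussian,
    Measure.map_map (by fun_prop) (by fun_prop), Measure.map_map (by fun_prop) (by fun_prop)]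
  rfl

end GaussianVector

/-- The factors are exchanged one at a time; all the others have modulus at most one, so each
exchange costs only its own difference. -/
lemma norm_prod_sub_prod_le_sum {ι : Type*} (s : Finset ι) (z w : ι → ℂ) (hz : ∀ k ∈ s, ‖z k‖ ≤ 1)
    (hw : ∀ k ∈ s, ‖w k‖ ≤ 1) : ‖∏ k ∈ s, z k - ∏ k ∈ s, w k‖ ≤ ∑ k ∈ s, ‖z k - w k‖ := by
  classical
  induction s using Finset.induction_on with
  | empty => simp
  | insert a s ha ih =>
    rw [Finset.prod_insert ha, Finset.prod_insert ha, Finset.sum_insert ha]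
    have h1 : ‖∏ k ∈ s, z k‖ ≤ 1 := by
      rw [norm_prod]
      exact Finset.prod_le_one (fun _ _ => norm_nonneg _)
        fun k hk => hz k (Finset.mem_insert_of_mem hk)
    have h2 := ih (fun k hk => hz k (Finset.mem_insert_of_mem hk))
      fun k hk => hw k (Finset.mem_insert_of_mem hk)
    have h3 := hw a (Finset.mem_insert_self _ _)
    calc ‖z a * ∏ k ∈ s, z k - w a * ∏ k ∈ s, w k‖
        = ‖(z a - w a) * ∏ k ∈ s, z k + w a * (∏ k ∈ s, z k - ∏ k ∈ s, w k)‖ := by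
          congr 1; ring
      _ ≤ ‖z a - w a‖ * ‖∏ k ∈ s, z k‖ + ‖w a‖ * ‖∏ k ∈ s, z k - ∏ k ∈ s, w k‖ := by
          refine (norm_add_le _ _).trans_eq ?_
          rw [norm_mul, norm_mul]
      _ ≤ ‖z a - w a‖ * 1 + 1 * ∑ k ∈ s, ‖z k - w k‖ := by gcongr
      _ = _ := by ring

/-! ### Weighted sums of squares of a Gaussian vector -/

section QuadraticForm

variable {ι : Type*} [Fintype ι] [DecidableEq ι] {Ω : Type*} [MeasurableSpace Ω] {P : Measure Ω}
  {Y : ι → Ω → ℝ} {S : Matrix ι ι ℝ}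

/-- Exact second moment of a centred weighted sum of squares of a Gaussian vector. -/
lemma integral_sq_weighted_sum_sq (hY : HasGaussianLaw (fun ω a => Y a ω) P)
    (h0 : ∀ a, ∫ ω, Y a ω ∂P = 0) (hS : ∀ a b, ∫ ω, Y a ω * Y b ω ∂P = S a b) (d : ι → ℝ) :
    ∫ ω, (∑ a, d a * (Y a ω ^ 2 - S a a)) ^ 2 ∂P = 2 * ∑ a, ∑ b, d a * d b * S a b ^ 2 := by
  have hpsd := posSemidef_of_integral_mul (fun a => (hY.eval a).memLp_two) hS
  obtain ⟨B, l, hB, hl⟩ := exists_factor_diagonalizing hpsd d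
  have hlaw := map_gaussianVector_eq hY h0 hS hB
  have hYm : AEMeasurable (fun ω a => Y a ω) P := hY.aemeasurable
  have e1 : ∫ ω, (∑ a, d a * (Y a ω ^ 2 - S a a)) ^ 2 ∂P
      = ∫ y, (∑ a, d a * (y a ^ 2 - S a a)) ^ 2 ∂(P.map (fun ω a => Y a ω)) := by
    rw [integral_map hYm (Continuous.aestronglyMeasurable (by fun_prop))]
  rw [e1, hlaw, integral_map (by fun_prop) (Continuous.aestronglyMeasurable (by fun_prop))]
  -- In the diagonalizing coordinates the statistic is a sum of independent terms; the centrings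
  -- agree because `∑ l k = ∑ d a * S a a`.
  have e2 : ∀ x : ι → ℝ, ∑ a, d a * ((B *ᵥ x) a ^ 2 - S a a) = ∑ k, l k * (x k ^ 2 - 1) := by
    intro x
    simp only [mul_sub, Finset.sum_sub_distrib, sum_mul_sq_mulVec hl, mul_one,
      sum_eigenvalues_eq hB hl]
  simp_rw [e2]
  have hv := variance_sum_pi (μ := fun _ : ι => gaussianReal 0 1)
    (X := fun k x => l k * (x ^ 2 - 1)) fun k => memLp_sq_sub_one_gaussianReal.const_mul (l k)
  have hint : ∀ k : ι, Integrable (fun x : ι → ℝ => l k * (x k ^ 2 - 1))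
      (Measure.pi fun _ : ι => gaussianReal 0 1) := fun k =>
    integrable_comp_eval (μ := fun _ : ι => gaussianReal 0 1) (i := k)
      (f := fun x => l k * (x ^ 2 - 1))
      ((memLp_sq_sub_one_gaussianReal.integrable (by norm_num)).const_mul (l k))
  have hm0 : ∫ x, (∑ k, fun x : ι → ℝ => l k * (x k ^ 2 - 1)) x
      ∂(Measure.pi fun _ : ι => gaussianReal 0 1) = 0 := by
    simp only [Finset.sum_apply]
    rw [integral_finsetSum _ fun k _ => hint k]
    refine Finset.sum_eq_zero fun k _ => ?_
    rw [integral_comp_eval (μ := fun _ : ι => gaussianReal 0 1) (i := k)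
      (f := fun x => l k * (x ^ 2 - 1)) (by fun_prop), integral_const_mul,
      integral_sq_sub_one_gaussianReal, mul_zero]
  rw [variance_of_integral_eq_zero (Finset.aemeasurable_sum _ fun k _ =>
    (hint k).aemeasurable) hm0] at hv
  simp only [Finset.sum_apply] at hv
  rw [hv, ← sum_sq_eigenvalues_eq hB hl, Finset.mul_sum]
  refine Finset.sum_congr rfl fun k _ => ?_
  rw [variance_const_mul, variance_of_integral_eq_zero (by fun_prop)
    integral_sq_sub_one_gaussianReal, integral_sq_sub_one_sq_gaussianReal]
  ring

end QuadraticForm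

/-- Quantitative normal approximation for the characteristic function of a weighted sum of squares
of a Gaussian vector, in terms of the absolute row sums of the weighted covariance matrix. -/
lemma exists_charFun_weighted_sum_sq_bound {ε : ℝ} (hε : 0 < ε) :
    ∃ δ > 0, ∀ {ι Ω : Type*} [Fintype ι] [DecidableEq ι] [MeasurableSpace Ω] {P : Measure Ω}
      {Y : ι → Ω → ℝ} {S : Matrix ι ι ℝ} (_ : HasGaussianLaw (fun ω a => Y a ω) P)
      (_ : ∀ a, ∫ ω, Y a ω ∂P = 0) (_ : ∀ a b, ∫ ω, Y a ω * Y b ω ∂P = S a b) (d : ι → ℝ)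
      (_ : ∀ a, ∑ b, |d a * S a b| ≤ δ),
      ‖(∫ ω, Complex.exp (((∑ a, d a * (Y a ω ^ 2 - S a a) : ℝ) : ℂ) * Complex.I) ∂P)
        - Complex.exp (-((∑ a, ∑ b, d a * d b * S a b ^ 2 : ℝ) : ℂ))‖
        ≤ ε * ∑ a, ∑ b, d a * d b * S a b ^ 2 := by
  obtain ⟨δ, hδ, hb⟩ := Metric.eventually_nhds_iff.1 (charFun_sq_sub_one_isLittleO.bound hε)
  -- Halving turns the non-strict row-sum bound into the strict inequality `|l k| < δ` under which
  -- the expansion is available.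
  refine ⟨δ / 2, half_pos hδ, ?_⟩
  intro ι Ω _ _ _ P Y S hY h0 hS d hd
  have hpsd := posSemidef_of_integral_mul (fun a => (hY.eval a).memLp_two) hS
  obtain ⟨B, l, hB, hl⟩ := exists_factor_diagonalizing hpsd d
  have hlaw := map_gaussianVector_eq hY h0 hS hB
  have hYm : AEMeasurable (fun ω a => Y a ω) P := hY.aemeasurable
  have e1 : ∫ ω, Complex.exp (((∑ a, d a * (Y a ω ^ 2 - S a a) : ℝ) : ℂ) * Complex.I) ∂P
      = ∫ y, Complex.exp (((∑ a, d a * (y a ^ 2 - S a a) : ℝ) : ℂ) * Complex.I)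
        ∂(P.map (fun ω a => Y a ω)) := by
    rw [integral_map hYm (Continuous.aestronglyMeasurable (by fun_prop))]
  rw [e1, hlaw, integral_map (by fun_prop) (Continuous.aestronglyMeasurable (by fun_prop))]
  have e2 : ∀ x : ι → ℝ, Complex.exp (((∑ a, d a * ((B *ᵥ x) a ^ 2 - S a a) : ℝ) : ℂ) * Complex.I)
      = ∏ k, Complex.exp (((l k * (x k ^ 2 - 1) : ℝ) : ℂ) * Complex.I) := by
    intro x
    rw [← Complex.exp_sum, ← Finset.sum_mul, ← Complex.ofReal_sum]
    simp only [mul_sub, Finset.sum_sub_distrib, sum_mul_sq_mulVec hl, mul_one,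
      sum_eigenvalues_eq hB hl]
  simp_rw [e2]
  rw [integral_fintype_prod_eq_prod (μ := fun _ : ι => gaussianReal 0 1)
    (f := fun k (x : ℝ) => Complex.exp (((l k * (x ^ 2 - 1) : ℝ) : ℂ) * Complex.I)),
    ← sum_sq_eigenvalues_eq hB hl, Complex.ofReal_sum, ← Finset.sum_neg_distrib, Complex.exp_sum,
    Finset.mul_sum]
  -- Factor `k` differs from `exp (-(l k) ^ 2)` by at most `ε * l k ^ 2`, and these errors add up.
  refine (norm_prod_sub_prod_le_sum _ _ _ (fun k _ => ?_) fun k _ => ?_).trans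
    (Finset.sum_le_sum fun k _ => ?_)
  · refine (norm_integral_le_integral_norm _).trans ?_
    simp_rw [Complex.norm_exp_ofReal_mul_I]
    simp
  · rw [Complex.norm_exp, Complex.neg_re, Complex.ofReal_re]
    exact Real.exp_le_one_iff.2 (neg_nonpos.2 (sq_nonneg _))
  · have hk : dist (l k) 0 < δ := by
      rw [dist_zero_right, Real.norm_eq_abs]
      exact (abs_eigenvalue_le_of_row_sum_le hB hl hd k).trans_lt (half_lt_self hδ)
    refine (hb hk).trans_eq ?_
    rw [norm_pow, Real.norm_eq_abs, sq_abs]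

/-! ### Mean value bounds for iterated differences -/

section FiniteDifferences

/-- The forward difference with step `s`. -/
def fwd (s : ℝ) (f : ℝ → ℝ) (x : ℝ) : ℝ := f (x + s) - f x

lemma hasDerivAt_fwd {f f' : ℝ → ℝ} {s x : ℝ} (h1 : HasDerivAt f (f' x) x)
    (h2 : HasDerivAt f (f' (x + s)) (x + s)) : HasDerivAt (fwd s f) (fwd s f' x) x :=
  (h2.comp_add_const x s).sub h1

lemma abs_fwd_le {f f' : ℝ → ℝ} {a b s M : ℝ} (hs : 0 ≤ s)
    (hf : ∀ x ∈ Set.Icc a b, HasDerivAt f (f' x) x) (hM : ∀ x ∈ Set.Icc a b, |f' x| ≤ M) :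
    ∀ x ∈ Set.Icc a (b - s), |fwd s f x| ≤ M * s := by
  intro x hx
  have h := (convex_Icc a b).norm_image_sub_le_of_norm_hasDerivWithin_le
    (fun y hy => (hf y hy).hasDerivWithinAt) (fun y hy => hM y hy)
    (x := x) (y := x + s) ⟨hx.1, by linarith [hx.2]⟩ ⟨by linarith [hx.1], by linarith [hx.2]⟩
  simpa [fwd, abs_of_nonneg hs] using h

/-- Differencing commutes with differentiation, so each difference trades one derivative for a
factor equal to its step, at the price of shortening the interval. -/
lemma abs_fwd_three_le {f₀ f₁ f₂ f₃ : ℝ → ℝ} {a b s₁ s₂ s₃ M : ℝ} (hs₁ : 0 ≤ s₁) (hs₂ : 0 ≤ s₂)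
    (hs₃ : 0 ≤ s₃) (h₀ : ∀ x ∈ Set.Icc a b, HasDerivAt f₀ (f₁ x) x)
    (h₁ : ∀ x ∈ Set.Icc a b, HasDerivAt f₁ (f₂ x) x)
    (h₂ : ∀ x ∈ Set.Icc a b, HasDerivAt f₂ (f₃ x) x) (hM : ∀ x ∈ Set.Icc a b, |f₃ x| ≤ M) :
    ∀ x ∈ Set.Icc a (b - s₁ - s₂ - s₃), |fwd s₃ (fwd s₂ (fwd s₁ f₀)) x| ≤ M * s₁ * s₂ * s₃ := by
  have hd : ∀ {g g' : ℝ → ℝ} {c : ℝ}, ∀ s, 0 ≤ s → (∀ x ∈ Set.Icc a c, HasDerivAt g (g' x) x) →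
      ∀ x ∈ Set.Icc a (c - s), HasDerivAt (fwd s g) (fwd s g' x) x := by
    intro g g' c s hs hg x hx
    exact hasDerivAt_fwd (hg x ⟨hx.1, by linarith [hx.2]⟩)
      (hg (x + s) ⟨by linarith [hx.1], by linarith [hx.2]⟩)
  exact abs_fwd_le hs₃ (hd s₂ hs₂ (hd s₁ hs₁ h₀))
    (abs_fwd_le hs₂ (hd s₁ hs₁ h₁) (abs_fwd_le hs₁ h₂ hM))

end FiniteDifferences

/-! ### Filtered covariances: limits and decay in the lag -/

lemma sum_Icc_neg_one_one (g : ℤ → ℝ) : ∑ k ∈ Finset.Icc (-1 : ℤ) 1, g k = g (-1) + g 0 + g 1 := by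
  rw [show Finset.Icc (-1 : ℤ) 1 = {-1, 0, 1} from rfl]
  simp [add_assoc]

/-- The filtered, rescaled version of a function at lag `h / n`; for a covariance function it is
the covariance of the filtered, discretized process at lag `h`. -/
noncomputable def scaledCov (a : ℝ) (f : ℝ → ℝ) (u v n : ℕ) (h : ℤ) : ℝ :=
  (n : ℝ) ^ a * ∑ j ∈ Finset.Icc (-1 : ℤ) 1, ∑ k ∈ Finset.Icc (-1 : ℤ) 1,
    filterCoeff j * filterCoeff k *
      f (((h : ℝ) + (k : ℝ) * (v : ℝ) - (j : ℝ) * (u : ℝ)) / (n : ℝ))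

lemma scaledCov_neg {f : ℝ → ℝ} (hf : ∀ t, f (-t) = f t) (a : ℝ) (u v n : ℕ) (h : ℤ) :
    scaledCov a f u v n (-h) = scaledCov a f u v n h := by
  have e : ∀ x y : ℝ, x = -y → f (x / n) = f (y / n) := by
    rintro x y rfl; rw [neg_div, hf]
  simp only [scaledCov, sum_Icc_neg_one_one, filterCoeff]
  push_cast
  rw [e (-h + -1 * v - -1 * u) (h + 1 * v - 1 * u) (by ring),
    e (-h + 0 * v - -1 * u) (h + 0 * v - 1 * u) (by ring),
    e (-h + 1 * v - -1 * u) (h + -1 * v - 1 * u) (by ring),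
    e (-h + -1 * v - 0 * u) (h + 1 * v - 0 * u) (by ring),
    e (-h + 0 * v - 0 * u) (h + 0 * v - 0 * u) (by ring),
    e (-h + 1 * v - 0 * u) (h + -1 * v - 0 * u) (by ring),
    e (-h + -1 * v - 1 * u) (h + 1 * v - -1 * u) (by ring),
    e (-h + 0 * v - 1 * u) (h + 0 * v - -1 * u) (by ring),
    e (-h + 1 * v - 1 * u) (h + -1 * v - -1 * u) (by ring)]
  congr 1
  simp
  ring

lemma filteredPower_neg_swap (a : ℝ) (u v : ℕ) (h : ℤ) :
    filteredPower a v u (-h) = filteredPower a u v h := by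
  have e : ∀ x y : ℝ, x = -y → |x| = |y| := by
    rintro x y rfl; rw [abs_neg]
  simp only [filteredPower, sum_Icc_neg_one_one, filterCoeff]
  push_cast
  rw [e (-h + -1 * u - -1 * v) (h + -1 * v - -1 * u) (by ring),
    e (-h + 0 * u - -1 * v) (h + -1 * v - 0 * u) (by ring),
    e (-h + 1 * u - -1 * v) (h + -1 * v - 1 * u) (by ring),
    e (-h + -1 * u - 0 * v) (h + 0 * v - -1 * u) (by ring),
    e (-h + 0 * u - 0 * v) (h + 0 * v - 0 * u) (by ring),
    e (-h + 1 * u - 0 * v) (h + 0 * v - 1 * u) (by ring),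
    e (-h + -1 * u - 1 * v) (h + 1 * v - -1 * u) (by ring),
    e (-h + 0 * u - 1 * v) (h + 1 * v - 0 * u) (by ring),
    e (-h + 1 * u - 1 * v) (h + 1 * v - 1 * u) (by ring)]
  simp
  ring

/-- Four index pairs at distance `u` have coefficient `-2` and two at distance `2 * u` have
coefficient `1`; the diagonal pairs vanish because `a > 0`. This is the origin of `8 - 2 ^ (α + 1)`
in `tau`. -/
lemma filteredPower_self_zero {a : ℝ} (ha : 0 < a) (u : ℕ) :
    filteredPower a u u 0 = (2 * 2 ^ a - 8) * (u : ℝ) ^ a := by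
  have h2 : ((2 : ℝ) * u) ^ a = 2 ^ a * (u : ℝ) ^ a :=
    Real.mul_rpow (by norm_num) (Nat.cast_nonneg u)
  have hu : |(u : ℝ)| = u := abs_of_nonneg (Nat.cast_nonneg u)
  have e1 : ∀ x : ℝ, x = 0 → |x| ^ a = 0 := by
    rintro x rfl; rw [abs_zero, Real.zero_rpow ha.ne']
  have e2 : ∀ x : ℝ, x = u ∨ x = -u → |x| ^ a = (u : ℝ) ^ a := by
    rintro x (rfl | rfl) <;> simp
  have e3 : ∀ x : ℝ, x = 2 * u ∨ x = -(2 * u) → |x| ^ a = 2 ^ a * (u : ℝ) ^ a := by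
    rintro x (rfl | rfl) <;> simp [abs_mul, h2]
  simp only [filteredPower, sum_Icc_neg_one_one, filterCoeff]
  push_cast
  rw [e1 (0 + -1 * u - -1 * u) (by ring), e2 (0 + 0 * u - -1 * u) (by left; ring),
    e3 (0 + 1 * u - -1 * u) (by left; ring), e2 (0 + -1 * u - 0 * u) (by right; ring),
    e1 (0 + 0 * u - 0 * u) (by ring), e2 (0 + 1 * u - 0 * u) (by left; ring),
    e3 (0 + -1 * u - 1 * u) (by right; ring), e2 (0 + 0 * u - 1 * u) (by right; ring),
    e1 (0 + 1 * u - 1 * u) (by ring)]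
  simp
  ring

lemma isLittleO_abs_rpow {a b : ℝ} (ha : 0 < a) (hab : a < b) :
    (fun t : ℝ => |t| ^ b) =o[𝓝 0] fun t : ℝ => |t| ^ a := by
  have h1 : (fun t : ℝ => |t| ^ b) = fun t : ℝ => |t| ^ (b - a) * |t| ^ a := by
    ext t
    rcases eq_or_ne t 0 with rfl | ht
    · rw [abs_zero, Real.zero_rpow (ha.trans hab).ne', Real.zero_rpow ha.ne', mul_zero]
    · rw [← Real.rpow_add (abs_pos.2 ht), sub_add_cancel]
  have h2 : Tendsto (fun t : ℝ => |t| ^ (b - a)) (𝓝 0) (𝓝 0) := by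
    have : Continuous fun t : ℝ => |t| ^ (b - a) :=
      continuous_abs.rpow_const fun _ => Or.inr (sub_pos.2 hab).le
    simpa [Real.zero_rpow (sub_pos.2 hab).ne'] using this.tendsto 0
  rw [h1]
  have := ((isLittleO_one_iff ℝ).2 h2).mul_isBigO (isBigO_refl (fun t : ℝ => |t| ^ a) (𝓝 0))
  simpa using this

lemma tendsto_rpow_mul_comp_div {R : ℝ → ℝ} {a : ℝ} (hR : R =o[𝓝 0] fun t : ℝ => |t| ^ a)
    (x : ℝ) : Tendsto (fun n : ℕ => (n : ℝ) ^ a * R (x / n)) atTop (𝓝 0) := by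
  have h1 : Tendsto (fun n : ℕ => x / (n : ℝ)) atTop (𝓝 0) := tendsto_const_div_atTop_nhds_zero_nat x
  have h2 := (isBigO_refl (fun n : ℕ => (n : ℝ) ^ a) atTop).mul_isLittleO (hR.comp_tendsto h1)
  have h3 : (fun n : ℕ => (n : ℝ) ^ a * ((fun t : ℝ => |t| ^ a) ∘ fun n : ℕ => x / (n : ℝ)) n)
      =O[atTop] fun _ : ℕ => (1 : ℝ) := by
    refine IsBigO.of_bound (|x| ^ a) ?_
    filter_upwards [eventually_gt_atTop 0] with n hn
    have hn' : (0 : ℝ) < n := Nat.cast_pos.2 hn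
    simp only [Function.comp]
    rw [abs_div, abs_of_pos hn', ← Real.mul_rpow hn'.le (by positivity), mul_div_cancel₀ _ hn'.ne',
      norm_one, mul_one, Real.norm_of_nonneg (by positivity)]
  exact (isLittleO_one_iff ℝ).1 (h2.trans_isBigO h3)

lemma tendsto_scaledCov_zero {R : ℝ → ℝ} {a : ℝ} (hR : R =o[𝓝 0] fun t : ℝ => |t| ^ a)
    (u v : ℕ) (h : ℤ) : Tendsto (fun n => scaledCov a R u v n h) atTop (𝓝 0) := by
  simp only [scaledCov, Finset.mul_sum]
  rw [show (0 : ℝ) = ∑ j ∈ Finset.Icc (-1 : ℤ) 1, ∑ k ∈ Finset.Icc (-1 : ℤ) 1, 0 by simp]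
  refine tendsto_finsetSum _ fun j _ => tendsto_finsetSum _ fun k _ => ?_
  have := (tendsto_rpow_mul_comp_div hR ((h : ℝ) + (k : ℝ) * (v : ℝ) - (j : ℝ) * (u : ℝ))).const_mul
    (filterCoeff j * filterCoeff k)
  rw [mul_zero] at this
  refine this.congr fun n => ?_
  ring

/-- The filter coefficients sum to zero, which removes the constant `s`, and `|t| ^ a` is
homogeneous, so the factor `n ^ a` exactly undoes the scaling by `1 / n`. Only the remainder of the
expansion is left. -/
lemma scaledCov_sub_eq (f : ℝ → ℝ) (a s b : ℝ) (u v n : ℕ) (hn : 0 < n) (h : ℤ) :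
    scaledCov a f u v n h - -b * filteredPower a u v h
      = scaledCov a (fun t => f t - (s - b * |t| ^ a)) u v n h := by
  have hn' : (0 : ℝ) < n := Nat.cast_pos.2 hn
  have h1 : ∀ x : ℝ, |x| ^ a = (n : ℝ) ^ a * |x / n| ^ a := fun x => by
    rw [abs_div, abs_of_pos hn', ← Real.mul_rpow hn'.le (by positivity), mul_div_cancel₀ _ hn'.ne']
  have h2 : filteredPower a u v h = (n : ℝ) ^ a * ∑ j ∈ Finset.Icc (-1 : ℤ) 1,
      ∑ k ∈ Finset.Icc (-1 : ℤ) 1, filterCoeff j * filterCoeff k *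
        |((h : ℝ) + (k : ℝ) * (v : ℝ) - (j : ℝ) * (u : ℝ)) / (n : ℝ)| ^ a := by
    simp only [filteredPower, Finset.mul_sum]
    refine Finset.sum_congr rfl fun j _ => Finset.sum_congr rfl fun k _ => ?_
    rw [h1]; ring
  rw [h2]
  simp only [scaledCov, sum_Icc_neg_one_one, filterCoeff]
  simp
  ring

lemma tendsto_scaledCov {f : ℝ → ℝ} {a s b : ℝ}
    (hf : (fun t => f t - (s - b * |t| ^ a)) =o[𝓝 0] fun t : ℝ => |t| ^ a) (u v : ℕ) (h : ℤ) :
    Tendsto (fun n => scaledCov a f u v n h) atTop (𝓝 (-b * filteredPower a u v h)) := by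
  rw [← tendsto_sub_nhds_zero_iff]
  refine (tendsto_scaledCov_zero hf u v h).congr' ?_
  filter_upwards [eventually_gt_atTop 0] with n hn
  rw [scaledCov_sub_eq f a s b u v n hn]

/-- The factor `√n` raises the normalizing exponent from `a` to `a + 1 / 2`, and a remainder of
order `a + β` is still negligible because `β > 1 / 2`. -/
lemma tendsto_sqrt_mul_scaledCov_sub {f : ℝ → ℝ} {a s b β : ℝ} (ha : 0 < a) (hβ : 1 / 2 < β)
    (hf : (fun t => f t - (s - b * |t| ^ a)) =O[𝓝 0] fun t : ℝ => |t| ^ (a + β))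
    (u v : ℕ) (h : ℤ) :
    Tendsto (fun n : ℕ => √(n : ℝ) * (scaledCov a f u v n h - -b * filteredPower a u v h))
      atTop (𝓝 0) := by
  have hR := hf.trans_isLittleO (isLittleO_abs_rpow (a := a + 1 / 2) (by linarith)
    (b := a + β) (by linarith))
  refine (tendsto_scaledCov_zero hR u v h).congr' ?_
  filter_upwards [eventually_gt_atTop 0] with n hn
  have hn' : (0 : ℝ) < n := Nat.cast_pos.2 hn
  rw [scaledCov_sub_eq f a s b u v n hn, scaledCov, scaledCov, Real.rpow_add hn',
    Real.sqrt_eq_rpow]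
  ring

/-- A bound on the fourth derivative near the origin gives a bound on the third derivative. -/
lemma exists_third_deriv_bound {f : ℝ → ℝ} {a r : ℝ} (ha : a < 2) (hr : 1 < r)
    (hd : ∀ t : ℝ, 0 < t → t < r → DifferentiableAt ℝ (iteratedDeriv 3 f) t)
    (h4 : iteratedDeriv 4 f =O[𝓝[≠] 0] fun t : ℝ => |t| ^ (a - 4)) :
    ∃ K : ℝ, 0 ≤ K ∧ ∀ t : ℝ, 0 < t → t ≤ (1 + r) / 2 → |iteratedDeriv 3 f t| ≤ K * t ^ (a - 3) := by
  obtain ⟨K₀, hK₀, hb⟩ := h4.exists_nonneg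
  rw [IsBigOWith, eventually_nhdsWithin_iff, Metric.eventually_nhds_iff] at hb
  obtain ⟨δ₀, hδ₀, hb⟩ := hb
  set δ := min (δ₀ / 2) 1 with hδ
  have hδpos : 0 < δ := lt_min (by linarith) one_pos
  have hδ1 : δ ≤ 1 := min_le_right _ _
  have hδ2 : δ < δ₀ := (min_le_left _ _).trans_lt (by linarith)
  set g := iteratedDeriv 3 f with hg
  set G : ℝ → ℝ := fun t => K₀ / (3 - a) * t ^ (a - 3) with hG
  have h3a : 0 < 3 - a := by linarith
  have hGd : ∀ t, 0 < t → HasDerivAt G (-(K₀ * t ^ (a - 4))) t := by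
    intro t ht
    have := (Real.hasDerivAt_rpow_const (p := a - 3) (Or.inl ht.ne')).const_mul (K₀ / (3 - a))
    convert! this using 1
    rw [show a - 3 - 1 = a - 4 by ring, show a - 3 = -(3 - a) by ring]
    field_simp
  have hgd : ∀ t, 0 < t → t < r → HasDerivAt g (iteratedDeriv 4 f t) t := by
    intro t ht htr
    have := (hd t ht htr).hasDerivAt
    rwa [← iteratedDeriv_succ] at this
  have hgb : ∀ t, 0 < t → t ≤ δ → |iteratedDeriv 4 f t| ≤ K₀ * t ^ (a - 4) := by
    intro t ht htδ
    have := hb (y := t) (by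
      rw [dist_zero_right, Real.norm_eq_abs, abs_of_pos ht]; linarith) ht.ne'
    rwa [Real.norm_eq_abs, abs_of_pos ht, Real.norm_of_nonneg (by positivity)] at this
  have hGpos : ∀ t, 0 < t → 0 ≤ G t := fun t ht => by
    simp only [hG]; positivity
  have hnear : ∀ t, 0 < t → t ≤ δ → |g t| ≤ |g δ| + G t := by
    intro t ht htδ
    -- `G` is chosen with `G' = -K₀ t ^ (a - 4)`, which dominates the derivative of `g`; hence `G +
    -- g` and `G - g` both decrease on `(0, δ]`.
    have key : ∀ e : ℝ, |e| = 1 → G δ + e * g δ ≤ G t + e * g t := by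
      intro e he
      have hder : ∀ x ∈ Set.Icc t δ, HasDerivAt (fun x => G x + e * g x)
          (-(K₀ * x ^ (a - 4)) + e * iteratedDeriv 4 f x) x := fun x hx =>
        (hGd x (ht.trans_le hx.1)).add
          ((hgd x (ht.trans_le hx.1) (by linarith [hx.2])).const_mul e)
      have hanti : AntitoneOn (fun x => G x + e * g x) (Set.Icc t δ) := by
        refine antitoneOn_of_deriv_nonpos (convex_Icc t δ)
          (fun x hx => (hder x hx).continuousAt.continuousWithinAt)
          (fun x hx => (hder x (interior_subset hx)).differentiableAt.differentiableWithinAt)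
          fun x hx => ?_
        have hx' := interior_subset hx
        rw [(hder x hx').deriv]
        have h1 := hgb x (ht.trans_le hx'.1) hx'.2
        have h2 : e * iteratedDeriv 4 f x ≤ |iteratedDeriv 4 f x| := by
          calc e * iteratedDeriv 4 f x ≤ |e * iteratedDeriv 4 f x| := le_abs_self _
            _ = _ := by rw [abs_mul, he, one_mul]
        linarith
      exact hanti ⟨le_rfl, htδ⟩ ⟨htδ, le_rfl⟩ htδ
    have k1 := key 1 (by simp)
    have k2 := key (-1) (by simp)
    have h1 := hGpos δ hδpos
    have h2 := le_abs_self (g δ)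
    have h3 := neg_abs_le (g δ)
    rw [abs_le]
    constructor <;> linarith
  -- Away from the origin compactness applies to the third derivative, which is continuous because
  -- it is differentiable; the fourth derivative is only known to exist there. The endpoint `(1 + r)
  -- / 2` lies strictly between `1` and `r`.
  obtain ⟨M, hM⟩ : ∃ M, ∀ t ∈ Set.Icc δ ((1 + r) / 2), ‖g t‖ ≤ M :=
    isCompact_Icc.exists_bound_of_continuousOn fun t ht =>
      (hgd t (hδpos.trans_le ht.1) (by linarith [ht.2])).continuousAt.continuousWithinAt
  have hM0 : 0 ≤ M := (norm_nonneg _).trans (hM δ ⟨le_rfl, by linarith⟩)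
  have hr' : 0 < (1 + r) / 2 := by linarith
  refine ⟨M * ((1 + r) / 2) ^ (3 - a) + K₀ / (3 - a), by positivity, fun t ht htr => ?_⟩
  have h1 : |g t| ≤ M + G t := by
    rcases le_total t δ with h | h
    · refine (hnear t ht h).trans ?_
      gcongr
      exact hM δ ⟨le_rfl, by linarith⟩
    · exact (hM t ⟨h, htr⟩).trans (le_add_of_nonneg_right (hGpos t ht))
  have h2 : (1 : ℝ) ≤ ((1 + r) / 2) ^ (3 - a) * t ^ (a - 3) := by
    rw [show a - 3 = -(3 - a) by ring, Real.rpow_neg ht.le, ← div_eq_mul_inv,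
      one_le_div (by positivity)]
    exact Real.rpow_le_rpow ht.le htr h3a.le
  calc |g t| ≤ M * 1 + G t := by rw [mul_one]; exact h1
    _ ≤ M * (((1 + r) / 2) ^ (3 - a) * t ^ (a - 3)) + G t := by gcongr
    _ = _ := by simp only [hG]; ring

/-- The filtered covariances decay polynomially in the lag, uniformly in the sample size. -/
lemma exists_scaledCov_bound {f : ℝ → ℝ} {a s b r : ℝ} (ha : a < 2) (hr : 1 < r)
    (heven : ∀ t, f (-t) = f t)
    (hd : ∀ k < 4, ∀ t : ℝ, 0 < |t| → |t| < r → DifferentiableAt ℝ (iteratedDeriv k f) t)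
    (h4 : iteratedDeriv 4 f =O[𝓝[≠] 0] fun t : ℝ => |t| ^ (a - 4))
    (hf : (fun t => f t - (s - b * |t| ^ a)) =o[𝓝 0] fun t : ℝ => |t| ^ a) (u v : ℕ) :
    ∃ K : ℝ, 0 ≤ K ∧ ∀ᶠ n : ℕ in atTop, ∀ h : ℤ, |h| < n →
      |scaledCov a f u v n h| ≤ K * (1 + |(h : ℝ)|) ^ (a - 3) := by
  obtain ⟨K, hK, hb⟩ := exists_third_deriv_bound ha hr
    (fun t ht htr => hd 3 (by norm_num) t (abs_pos.2 ht.ne') (by rwa [abs_of_pos ht])) h4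
  -- For `h ≥ H` every argument of `f` is at least `h / (2 * n) > 0`, so the derivative bounds
  -- apply. The finitely many smaller lags are covered by convergence.
  set H : ℕ := 2 * (u + v) + 1 with hH
  have h3a : 0 < 3 - a := by linarith
  have hneg3 : ∀ x : ℝ, 0 < x → x ^ (a - 3) = (x ^ (3 - a))⁻¹ := fun x hx => by
    rw [← Real.rpow_neg hx.le]; congr 1; ring
  set K₂ : ℝ := ∑ h ∈ Finset.Icc (-(H : ℤ)) H, (|-b * filteredPower a u v h| + 1) with hK₂
  have hK₂0 : 0 ≤ K₂ := Finset.sum_nonneg fun _ _ => by positivity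
  have hsmall : ∀ᶠ n : ℕ in atTop, ∀ h ∈ Finset.Icc (-(H : ℤ)) H, |scaledCov a f u v n h| ≤ K₂ := by
    refine (Filter.eventually_all_finset _).2 fun h hh => ?_
    have ht := (tendsto_scaledCov hf u v h).abs
    filter_upwards [ht.eventually (eventually_lt_nhds (lt_add_one _))] with n hn
    refine hn.le.trans ?_
    exact Finset.single_le_sum (f := fun h => |-b * filteredPower a u v h| + 1)
      (fun _ _ => by positivity) hh
  have hlarge : ∀ᶠ n : ℕ in atTop, ∀ h : ℤ, (H : ℤ) ≤ h → h < n →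
      |scaledCov a f u v n h| ≤ (2 * K * (u * v * v) * 4 ^ (3 - a)) * (1 + |(h : ℝ)|) ^ (a - 3) := by
    -- This keeps every argument `x + k * V - j * U`, with `x < 1`, below `(1 + r) / 2`.
    have he : ∀ᶠ n : ℕ in atTop, ((u + v : ℕ) : ℝ) / n < (r - 1) / 2 :=
      (tendsto_const_div_atTop_nhds_zero_nat _).eventually (eventually_lt_nhds (by linarith))
    filter_upwards [he, eventually_gt_atTop 0] with n hn hn0 h hHh hhn
    have hn' : (0 : ℝ) < n := Nat.cast_pos.2 hn0
    have hhR : (2 * (u + v) + 1 : ℝ) ≤ h := by exact_mod_cast hHh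
    have hu0 : (0 : ℝ) ≤ u := Nat.cast_nonneg u
    have hv0 : (0 : ℝ) ≤ v := Nat.cast_nonneg v
    have hhnR : (h : ℝ) < n := by exact_mod_cast hhn
    have hhpos : (0 : ℝ) < h := by linarith
    set U : ℝ := u / n with hU
    set V : ℝ := v / n with hV
    have hU0 : 0 ≤ U := by positivity
    have hV0 : 0 ≤ V := by positivity
    set x : ℝ := h / n with hx
    have hx1 : x < 1 := (div_lt_one hn').2 hhnR
    have hx0 : 0 < x := by positivity
    have hUV : U + V < (r - 1) / 2 := by
      have : U + V = ((u + v : ℕ) : ℝ) / n := by push_cast; rw [hU, hV]; ring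
      rw [this]; exact hn
    have hlow : x / 2 ≤ x - U - V := by
      have : x - U - V - x / 2 = (h - 2 * (u + v)) / (2 * n) := by
        rw [hx, hU, hV]; field_simp; ring
      have h2 : (0 : ℝ) ≤ (h - 2 * (u + v)) / (2 * n) := div_nonneg (by linarith) (by linarith)
      linarith
    set lo := x - U - V with hlo
    set hi := x + U + V with hhi
    have hdom : ∀ t ∈ Set.Icc lo hi, 0 < t ∧ t ≤ (1 + r) / 2 := fun t ht =>
      ⟨by linarith [ht.1], by linarith [ht.2]⟩
    have hder : ∀ k < 3, ∀ t ∈ Set.Icc lo hi,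
        HasDerivAt (iteratedDeriv k f) (iteratedDeriv (k + 1) f t) t := by
      intro k hk t ht
      have h0 := hdom t ht
      have := (hd k (by omega) t (abs_pos.2 h0.1.ne') (by
        rw [abs_of_pos h0.1]; linarith [h0.2])).hasDerivAt
      rwa [← iteratedDeriv_succ] at this
    have hMb : ∀ t ∈ Set.Icc lo hi, |iteratedDeriv 3 f t| ≤ K * (x / 2) ^ (a - 3) := by
      intro t ht
      have h0 := hdom t ht
      refine (hb t h0.1 h0.2).trans (mul_le_mul_of_nonneg_left ?_ hK)
      exact Real.rpow_le_rpow_of_nonpos (by positivity) (hlow.trans ht.1) (by linarith)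
    have h3 := abs_fwd_three_le hU0 hV0 hV0 (hder 0 (by norm_num)) (hder 1 (by norm_num))
      (hder 2 (by norm_num)) hMb
    rw [iteratedDeriv_zero] at h3
    set T := fwd V (fwd V (fwd U f)) with hT
    -- The double filter is a fourth-order difference. Three differences are estimated by the third
    -- derivative and the last one by the triangle inequality; the resulting exponent `a - 3 < -1`
    -- is enough for summability.
    have hsum : scaledCov a f u v n h = (n : ℝ) ^ a * (T (x - V) - T (x - U - V)) := by
      have e : ∀ j k : ℝ, ((h : ℝ) + k * v - j * u) / n = x + k * V - j * U := fun j k => by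
        rw [hx, hU, hV]; ring
      simp only [scaledCov, sum_Icc_neg_one_one, filterCoeff, e, hT, fwd]
      congr 1
      rw [show x - V + V + V + U = x + 1 * V - -1 * U by ring,
        show x - V + V + V = x + 1 * V - 0 * U by ring,
        show x - V + V + U = x + 0 * V - -1 * U by ring,
        show x - V + V = x + 0 * V - 0 * U by ring,
        show x - V + U = x + -1 * V - -1 * U by ring,
        show x - U - V + V + V + U = x + 1 * V - 0 * U by ring,
        show x - U - V + V + V = x + 1 * V - 1 * U by ring,
        show x - U - V + V + U = x + 0 * V - 0 * U by ring,
        show x - U - V + V = x + 0 * V - 1 * U by ring,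
        show x - U - V + U = x + -1 * V - 0 * U by ring,
        show x - U - V = x + -1 * V - 1 * U by ring,
        show x - V = x + -1 * V - 0 * U by ring]
      simp
      ring
    have t1 := h3 (x - V) ⟨by rw [hlo]; linarith, by rw [hhi]; linarith⟩
    have t2 := h3 (x - U - V) ⟨le_rfl, by rw [hhi]; linarith⟩
    rw [hsum, abs_mul, abs_of_nonneg (by positivity : (0 : ℝ) ≤ (n : ℝ) ^ a)]
    have habs : |T (x - V) - T (x - U - V)| ≤ 2 * (K * (x / 2) ^ (a - 3) * U * V * V) := by
      rw [two_mul]; exact (abs_sub _ _).trans (add_le_add t1 t2)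
    have hpow : (n : ℝ) ^ a * ((x / 2) ^ (a - 3) * (U * V * V))
        ≤ u * v * v * 4 ^ (3 - a) * (1 + |(h : ℝ)|) ^ (a - 3) := by
      have e1 : (x / 2) ^ (a - 3) = (n : ℝ) ^ (3 - a) * ((h : ℝ) / 2) ^ (a - 3) := by
        rw [show x / 2 = (h / 2) / n by rw [hx]; ring, Real.div_rpow (by positivity) hn'.le,
          hneg3 n hn', div_inv_eq_mul, mul_comm]
      have e2 : (n : ℝ) ^ a * (n : ℝ) ^ (3 - a) = (n : ℝ) ^ 3 := by
        rw [← Real.rpow_add hn', show a + (3 - a) = ((3 : ℕ) : ℝ) by norm_num, Real.rpow_natCast]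
      -- The constant `4` comes from `1 + h ≤ 4 * (h / 2)`, valid for `h ≥ 1`.
      have e3 : ((h : ℝ) / 2) ^ (a - 3) ≤ 4 ^ (3 - a) * (1 + |(h : ℝ)|) ^ (a - 3) := by
        rw [abs_of_pos hhpos, hneg3 _ (by positivity), hneg3 _ (by positivity), ← div_eq_mul_inv,
          le_div_iff₀ (by positivity), inv_mul_le_iff₀ (by positivity),
          ← Real.mul_rpow (by positivity) (by norm_num)]
        exact Real.rpow_le_rpow (by positivity) (by linarith) h3a.le
      calc (n : ℝ) ^ a * ((x / 2) ^ (a - 3) * (U * V * V))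
          = ((n : ℝ) ^ a * (n : ℝ) ^ (3 - a)) * (U * V * V) * ((h : ℝ) / 2) ^ (a - 3) := by
            rw [e1]; ring
        _ = u * v * v * ((h : ℝ) / 2) ^ (a - 3) := by
            rw [e2, hU, hV]; field_simp
        _ ≤ u * v * v * (4 ^ (3 - a) * (1 + |(h : ℝ)|) ^ (a - 3)) := by gcongr
        _ = _ := by ring
    calc (n : ℝ) ^ a * |T (x - V) - T (x - U - V)|
        ≤ (n : ℝ) ^ a * (2 * (K * (x / 2) ^ (a - 3) * U * V * V)) := by gcongr
      _ = 2 * K * ((n : ℝ) ^ a * ((x / 2) ^ (a - 3) * (U * V * V))) := by ring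
      _ ≤ 2 * K * (u * v * v * 4 ^ (3 - a) * (1 + |(h : ℝ)|) ^ (a - 3)) := by gcongr
      _ = _ := by ring
  refine ⟨2 * K * (u * v * v) * 4 ^ (3 - a) + K₂ * (1 + H) ^ (3 - a), by positivity, ?_⟩
  filter_upwards [hsmall, hlarge] with n hs hl h hhn
  have hpos : (0 : ℝ) < (1 + |(h : ℝ)|) ^ (a - 3) := by positivity
  rw [add_mul]
  rcases le_or_gt |h| H with hh | hh
  · refine (hs h (Finset.mem_Icc.2 (abs_le.1 hh))).trans ?_
    have h1 : (1 : ℝ) ≤ (1 + H) ^ (3 - a) * (1 + |(h : ℝ)|) ^ (a - 3) := by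
      rw [hneg3 _ (by positivity), ← div_eq_mul_inv, one_le_div (by positivity)]
      have : |(h : ℝ)| ≤ H := by exact_mod_cast hh
      exact Real.rpow_le_rpow (by positivity) (by linarith) h3a.le
    have h2 : (0 : ℝ) ≤ 2 * K * (u * v * v) * 4 ^ (3 - a) * (1 + |(h : ℝ)|) ^ (a - 3) := by positivity
    nlinarith [mul_le_mul_of_nonneg_left h1 hK₂0]
  · have h2 : (0 : ℝ) ≤ K₂ * (1 + H) ^ (3 - a) * (1 + |(h : ℝ)|) ^ (a - 3) := by positivity
    refine le_trans ?_ (le_add_of_nonneg_right h2)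
    rcases le_total 0 h with h0 | h0
    · rw [abs_of_nonneg h0] at hh hhn
      exact hl h hh.le hhn
    · rw [abs_of_nonpos h0] at hh hhn
      have := hl (-h) hh.le hhn
      rw [scaledCov_neg heven] at this
      simpa using this

/-! ### Double sums over pairs of times as sums over lags -/

section LagSums

/-- Summation over pairs of indices, organised by their difference. -/
lemma sum_sum_sub_eq (n : ℕ) (g : ℤ → ℝ) :
    ∑ j : Fin n, ∑ k : Fin n, g ((k : ℤ) - (j : ℤ))
      = ∑ h ∈ Finset.Ioo (-(n : ℤ)) n, ((n : ℝ) - |(h : ℝ)|) * g h := by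
  have h1 : ∀ j : Fin n, ∑ k : Fin n, g ((k : ℤ) - (j : ℤ))
      = ∑ h ∈ Finset.Ioo (-(n : ℤ)) n, if 0 ≤ (j : ℤ) + h ∧ (j : ℤ) + h < n then g h else 0 := by
    intro j
    rw [← Finset.sum_filter]
    refine Finset.sum_bij (fun k _ => (k : ℤ) - (j : ℤ)) (fun k _ => ?_) (fun k _ k' _ h => ?_)
      (fun h hh => ?_) fun _ _ => rfl
    · rw [Finset.mem_filter, Finset.mem_Ioo]; omega
    · ext; omega
    · rw [Finset.mem_filter, Finset.mem_Ioo] at hh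
      exact ⟨⟨((j : ℤ) + h).toNat, by omega⟩, Finset.mem_univ _, by simp only; omega⟩
  simp_rw [h1]
  rw [Finset.sum_comm]
  refine Finset.sum_congr rfl fun h hh => ?_
  rw [Finset.mem_Ioo] at hh
  rw [Fin.sum_univ_eq_sum_range (fun j => if 0 ≤ (j : ℤ) + h ∧ (j : ℤ) + h < n then g h else 0),
    ← Finset.sum_filter, Finset.sum_const, nsmul_eq_mul]
  congr 1
  have h2 : (Finset.range n).filter (fun j : ℕ => 0 ≤ (j : ℤ) + h ∧ (j : ℤ) + h < n)
      = Finset.Ico (-h).toNat (min n (n - h).toNat) := by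
    ext j
    simp only [Finset.mem_filter, Finset.mem_range, Finset.mem_Ico]
    omega
  rw [h2, Nat.card_Ico]
  have h3 : ((min n (n - h).toNat - (-h).toNat : ℕ) : ℤ) = n - |h| := by
    rcases abs_cases h with ⟨h4, h5⟩ | ⟨h4, h5⟩ <;> rw [h4] <;> omega
  exact_mod_cast congrArg (Int.cast : ℤ → ℝ) h3

lemma summable_one_add_abs_rpow {e : ℝ} (he : e < -1) :
    Summable fun h : ℤ => (1 + |(h : ℝ)|) ^ e := by
  have h1 : Summable fun n : ℕ => (1 + |((n : ℤ) : ℝ)|) ^ e := by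
    have := (summable_nat_add_iff 1).2 (Real.summable_nat_rpow.2 he)
    refine this.congr fun n => ?_
    simp [add_comm]
  refine Summable.of_nat_of_neg h1 ?_
  simpa using h1

variable {γ : ℕ → ℤ → ℝ} {γ₀ : ℤ → ℝ} {F : ℤ → ℝ}

lemma abs_le_of_tendsto_of_lag_bound (hlim : ∀ h, Tendsto (fun n => γ n h) atTop (𝓝 (γ₀ h)))
    (hb : ∀ᶠ n : ℕ in atTop, ∀ h : ℤ, |h| < n → |γ n h| ≤ F h) (h : ℤ) : |γ₀ h| ≤ F h := by
  refine le_of_tendsto (hlim h).abs ?_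
  filter_upwards [hb, eventually_gt_atTop h.natAbs] with n hn hh
  exact hn h (by rw [Int.abs_eq_natAbs]; exact_mod_cast hh)

/-- Outside a finite set `F < 1`, so there `γ₀ ^ 2 ≤ F ^ 2 ≤ F`. -/
lemma summable_sq_of_abs_le (hF : Summable F) (h : ∀ h, |γ₀ h| ≤ F h) :
    Summable fun h => γ₀ h ^ 2 := by
  refine Summable.of_norm_bounded_eventually hF ?_
  filter_upwards [hF.tendsto_cofinite_zero.eventually (eventually_lt_nhds one_pos)] with k hk
  rw [norm_pow, Real.norm_eq_abs, sq]
  nlinarith [h k, abs_nonneg (γ₀ k)]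

/-- Lag `h` carries the Fejér weight `1 - |h| / n`, which tends to one; dominated convergence
applies with majorant `F ^ 2`. -/
lemma tendsto_average_sq (hF : Summable F)
    (hlim : ∀ h, Tendsto (fun n => γ n h) atTop (𝓝 (γ₀ h)))
    (hb : ∀ᶠ n : ℕ in atTop, ∀ h : ℤ, |h| < n → |γ n h| ≤ F h) :
    Tendsto (fun n : ℕ => (1 / (n : ℝ)) * ∑ j : Fin n, ∑ k : Fin n, γ n ((k : ℤ) - (j : ℤ)) ^ 2)
      atTop (𝓝 (∑' h, γ₀ h ^ 2)) := by
  have hF0 : ∀ h, 0 ≤ F h := fun h =>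
    (abs_nonneg _).trans (abs_le_of_tendsto_of_lag_bound hlim hb h)
  have hF2 : Summable fun h => F h ^ 2 :=
    summable_sq_of_abs_le hF fun h => (abs_of_nonneg (hF0 h)).le
  have e : ∀ n : ℕ, (1 / (n : ℝ)) * ∑ j : Fin n, ∑ k : Fin n, γ n ((k : ℤ) - (j : ℤ)) ^ 2
      = ∑' h : ℤ, if h ∈ Finset.Ioo (-(n : ℤ)) n then
          (1 / (n : ℝ)) * (((n : ℝ) - |(h : ℝ)|) * γ n h ^ 2) else 0 := by
    intro n
    rw [sum_sum_sub_eq n fun h => γ n h ^ 2, Finset.mul_sum,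
      tsum_eq_sum (s := Finset.Ioo (-(n : ℤ)) n) fun h hh => if_neg hh]
    exact Finset.sum_congr rfl fun h hh => (if_pos hh).symm
  simp_rw [e]
  refine tendsto_tsum_of_dominated_convergence hF2 (fun h => ?_) ?_
  · have h1 : Tendsto (fun n : ℕ => (1 - |(h : ℝ)| / n) * γ n h ^ 2) atTop
        (𝓝 ((1 - 0) * γ₀ h ^ 2)) :=
      ((tendsto_const_div_atTop_nhds_zero_nat _).const_sub 1).mul ((hlim h).pow 2)
    rw [sub_zero, one_mul] at h1
    refine h1.congr' ?_
    filter_upwards [eventually_gt_atTop h.natAbs] with n hn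
    have hn' : (n : ℝ) ≠ 0 := Nat.cast_ne_zero.2 (by omega)
    rw [if_pos (Finset.mem_Ioo.2 (by omega))]
    field_simp
  · filter_upwards [hb, eventually_gt_atTop 0] with n hn hn0 h
    have hn' : (0 : ℝ) < n := Nat.cast_pos.2 hn0
    split_ifs with hh
    · rw [Finset.mem_Ioo] at hh
      have hlt : |h| < n := abs_lt.2 hh
      have hltR : |(h : ℝ)| < n := by exact_mod_cast hlt
      have h1 : γ n h ^ 2 ≤ F h ^ 2 := sq_le_sq' (abs_le.1 (hn h hlt)).1 (abs_le.1 (hn h hlt)).2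
      rw [Real.norm_of_nonneg (mul_nonneg (by positivity)
        (mul_nonneg (sub_nonneg.2 hltR.le) (sq_nonneg _)))]
      calc 1 / (n : ℝ) * (((n : ℝ) - |(h : ℝ)|) * γ n h ^ 2)
          ≤ 1 / (n : ℝ) * (n * F h ^ 2) := by
            gcongr
            linarith [abs_nonneg (h : ℝ)]
        _ = F h ^ 2 := by field_simp
    · rw [norm_zero]; positivity

lemma sum_abs_lag_le_tsum (hF : Summable F) (hF0 : ∀ h, 0 ≤ F h) {n : ℕ}
    (hb : ∀ h : ℤ, |h| < n → |γ n h| ≤ F h) (j : Fin n) :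
    ∑ k : Fin n, |γ n ((k : ℤ) - (j : ℤ))| ≤ ∑' h, F h := by
  calc ∑ k : Fin n, |γ n ((k : ℤ) - (j : ℤ))| ≤ ∑ k : Fin n, F ((k : ℤ) - (j : ℤ)) :=
        Finset.sum_le_sum fun k _ => hb _ (abs_lt.2 (by omega))
    _ = ∑ h ∈ Finset.univ.map ⟨fun k : Fin n => (k : ℤ) - (j : ℤ), fun a b hab => by
          ext; simp only at hab; omega⟩, F h := by rw [Finset.sum_map]; rfl
    _ ≤ ∑' h, F h := hF.sum_le_tsum _ fun h _ => hF0 h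

end LagSums

/-! ### Consequences of the covariance assumptions -/

section CovarianceModel

variable {Ω : Type*} [MeasurableSpace Ω] {P : Measure Ω} {X : Fin 2 → ℝ → Ω → ℝ}
  {C : Fin 2 → Fin 2 → ℝ → ℝ} {p : Params} {β₁₁ β₂₂ β₁₂ : ℝ}

lemma CondA3.cross_eq (hA3 : CondA3 p β₁₁ β₂₂ β₁₂ C) : C 1 0 = C 0 1 :=
  funext fun t => (hA3.symm t).symm

/-- Stationarity gives `C i j (-t) = C j i t`; symmetry of the cross covariance then yields
evenness. -/
lemma CondA3.even (hX : IsStationaryGaussian X C P) (hA3 : CondA3 p β₁₁ β₂₂ β₁₂ C) (i j : Fin 2)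
    (t : ℝ) : C i j (-t) = C i j t := by
  have h1 : C i j (-t) = C j i t := by
    rw [← hX.covariance i j t (-t), ← hX.covariance j i 0 t, add_neg_cancel, zero_add]
    simp_rw [mul_comm]
  rw [h1]
  fin_cases i <;> fin_cases j
  · rfl
  · exact congrFun hA3.cross_eq t
  · exact (congrFun hA3.cross_eq t).symm
  · rfl

lemma CondA3.α_mem (hA3 : CondA3 p β₁₁ β₂₂ β₁₂ C) (i : Fin 2) : p.α i ∈ Set.Ioo (0 : ℝ) 2 := by
  fin_cases i
  · exact hA3.inRange.α₁₁_mem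
  · exact hA3.inRange.α₂₂_mem

lemma CondA3.c_pos (hA3 : CondA3 p β₁₁ β₂₂ β₁₂ C) (i : Fin 2) : 0 < p.c i := by
  fin_cases i
  · exact hA3.inRange.c₁₁_pos
  · exact hA3.inRange.c₂₂_pos

lemma CondA3.mean_le_cross (hA3 : CondA3 p β₁₁ β₂₂ β₁₂ C) : (p.α₁₁ + p.α₂₂) / 2 ≤ p.α₁₂ := by
  rcases hA3.compatible with h | h
  · exact h.le
  · exact h.1.le

/-- The normalization of the two components imposes the exponent `(α₁₁ + α₂₂) / 2` on the cross
covariance. If it is smaller than `α₁₂`, the cross singularity is negligible at this scale and `b =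
0`; otherwise the exponents coincide. -/
lemma CondA3.cross_expansion (hA3 : CondA3 p β₁₁ β₂₂ β₁₂ C) :
    ∃ s b : ℝ, ((fun t => C 0 1 t - (s - b * |t| ^ ((p.α₁₁ + p.α₂₂) / 2)))
        =o[𝓝 0] fun t : ℝ => |t| ^ ((p.α₁₁ + p.α₂₂) / 2)) ∧
      ∀ (u v : ℕ) (h : ℤ), -b * filteredPower ((p.α₁₁ + p.α₂₂) / 2) u v h
        = if (p.α₁₁ + p.α₂₂) / 2 < p.α₁₂ then 0
          else -(p.ρ * p.σ₁ * p.σ₂ * p.c₁₂) * filteredPower p.α₁₂ u v h := by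
  have h1 := hA3.inRange.α₁₁_mem.1
  have h2 := hA3.inRange.α₂₂_mem.1
  have hpos : 0 < (p.α₁₁ + p.α₂₂) / 2 := by linarith
  have hβ := hA3.β₁₂_pos
  have hle := hA3.mean_le_cross
  have hR := hA3.expansion₁₂.trans_isLittleO
    (isLittleO_abs_rpow hpos (b := p.α₁₂ + β₁₂) (by linarith))
  by_cases hlt : (p.α₁₁ + p.α₂₂) / 2 < p.α₁₂
  · refine ⟨p.ρ * p.σ₁ * p.σ₂, 0, ?_, fun u v h => by rw [if_pos hlt]; ring⟩
    have h3 := (isLittleO_abs_rpow hpos hlt).const_mul_left (p.ρ * p.σ₁ * p.σ₂ * p.c₁₂)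
    refine (hR.sub h3).congr_left fun t => ?_
    ring
  · have heq : (p.α₁₁ + p.α₂₂) / 2 = p.α₁₂ := le_antisymm hle (not_lt.1 hlt)
    refine ⟨p.ρ * p.σ₁ * p.σ₂, p.ρ * p.σ₁ * p.σ₂ * p.c₁₂, ?_, fun u v h => by
      rw [if_neg hlt, heq]⟩
    rw [heq] at hR ⊢
    refine hR.congr_left fun t => ?_
    ring

/-- All four covariance functions have a first order expansion at the scale of the marginals. -/
lemma CondA3.expansion (hA3 : CondA3 p β₁₁ β₂₂ β₁₂ C) (i j : Fin 2) :
    ∃ s b : ℝ, ((fun t => C i j t - (s - b * |t| ^ ((p.α i + p.α j) / 2)))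
        =o[𝓝 0] fun t : ℝ => |t| ^ ((p.α i + p.α j) / 2)) ∧
      ∀ (u v : ℕ) (h : ℤ), -b * filteredPower ((p.α i + p.α j) / 2) u v h = sigma0 p i j u v h := by
  have e11 : (p.α₁₁ + p.α₁₁) / 2 = p.α₁₁ := by ring
  have e22 : (p.α₂₂ + p.α₂₂) / 2 = p.α₂₂ := by ring
  fin_cases i <;> fin_cases j <;> simp only [Fin.zero_eta, Fin.mk_one, Params.α, Params.c, sigma0,
    Matrix.cons_val_zero, Matrix.cons_val_one, if_true, zero_ne_one, one_ne_zero, if_false]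
  · refine ⟨p.σ₁ ^ 2, p.c₁₁, ?_, fun u v h => by rw [e11]⟩
    rw [e11]
    exact hA3.expansion₁₁.trans_isLittleO (isLittleO_abs_rpow hA3.inRange.α₁₁_mem.1
      (by linarith [hA3.β₁₁_pos]))
  · exact hA3.cross_expansion
  · rw [add_comm p.α₂₂, hA3.cross_eq]
    exact hA3.cross_expansion
  · refine ⟨p.σ₂ ^ 2, p.c₂₂, ?_, fun u v h => by rw [e22]⟩
    rw [e22]
    exact hA3.expansion₂₂.trans_isLittleO (isLittleO_abs_rpow hA3.inRange.α₂₂_mem.1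
      (by linarith [hA3.β₂₂_pos]))

lemma isBigO_of_sub_mul_isLittleO {f g : ℝ → ℝ} {c : ℝ} {l : Filter ℝ}
    (h : (fun t => f t - c * g t) =o[l] g) : f =O[l] g := by
  refine (h.isBigO.add (isBigO_const_mul_self c g l)).congr_left fun t => ?_
  ring

lemma CondA2.fourth_isBigO (hA2 : CondA2 p C) (hA3 : CondA3 p β₁₁ β₂₂ β₁₂ C) (i j : Fin 2) :
    iteratedDeriv 4 (C i j) =O[𝓝[≠] 0] fun t : ℝ => |t| ^ ((p.α i + p.α j) / 2 - 4) := by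
  have e11 : (p.α₁₁ + p.α₁₁) / 2 = p.α₁₁ := by ring
  have e22 : (p.α₂₂ + p.α₂₂) / 2 = p.α₂₂ := by ring
  have hcross : iteratedDeriv 4 (C 0 1)
      =O[𝓝[≠] 0] fun t : ℝ => |t| ^ ((p.α₁₁ + p.α₂₂) / 2 - 4) := by
    refine (isBigO_of_sub_mul_isLittleO hA2.fourth₁₂).trans (IsBigO.of_bound 1 ?_)
    rw [eventually_nhdsWithin_iff]
    filter_upwards [Metric.ball_mem_nhds (0 : ℝ) one_pos] with t ht ht0
    rw [Metric.mem_ball, dist_zero_right, Real.norm_eq_abs] at ht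
    rw [Real.norm_of_nonneg (by positivity), Real.norm_of_nonneg (by positivity), one_mul]
    exact Real.rpow_le_rpow_of_exponent_ge (abs_pos.2 ht0) ht.le (by linarith [hA3.mean_le_cross])
  fin_cases i <;> fin_cases j <;> simp only [Fin.zero_eta, Fin.mk_one, Params.α,
    Matrix.cons_val_zero, Matrix.cons_val_one]
  · rw [e11]; exact isBigO_of_sub_mul_isLittleO hA2.fourth₁₁
  · exact hcross
  · rw [add_comm p.α₂₂, hA3.cross_eq]; exact hcross
  · rw [e22]; exact isBigO_of_sub_mul_isLittleO hA2.fourth₂₂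

/-- The covariance at lag `h` of the filtered processes with (component, dilation) labels `a, b`. -/
noncomputable def lagCov (p : Params) (C : Fin 2 → Fin 2 → ℝ → ℝ) {m : ℕ} (n : ℕ)
    (a b : Fin 2 × Fin m) (h : ℤ) : ℝ :=
  scaledCov ((p.α a.1 + p.α b.1) / 2) (C a.1 b.1) (dilation a.2) (dilation b.2) n h

lemma tendsto_lagCov (hA3 : CondA3 p β₁₁ β₂₂ β₁₂ C) {m : ℕ} (a b : Fin 2 × Fin m) (h : ℤ) :
    Tendsto (fun n => lagCov p C n a b h) atTop
      (𝓝 (sigma0 p a.1 b.1 (dilation a.2) (dilation b.2) h)) := by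
  obtain ⟨s, c, h1, h2⟩ := hA3.expansion a.1 b.1
  rw [← h2]
  exact tendsto_scaledCov h1 _ _ h

/-- This envelope, summable in the lag and independent of `n`, expresses short memory; all later
uses of the fourth-derivative condition pass through it. -/
lemma exists_lagCov_bound (hX : IsStationaryGaussian X C P) (hA2 : CondA2 p C)
    (hA3 : CondA3 p β₁₁ β₂₂ β₁₂ C) (m : ℕ) :
    ∃ F : Fin 2 × Fin m → Fin 2 × Fin m → ℤ → ℝ, (∀ a b, Summable (F a b)) ∧
      (∀ a b h, 0 ≤ F a b h) ∧
      ∀ᶠ n : ℕ in atTop, ∀ a b, ∀ h : ℤ, |h| < n → |lagCov p C n a b h| ≤ F a b h := by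
  obtain ⟨r, hr, hd⟩ := hA2.differentiable
  have hα : ∀ a b : Fin 2 × Fin m, (p.α a.1 + p.α b.1) / 2 < 2 := fun a b => by
    linarith [(hA3.α_mem a.1).2, (hA3.α_mem b.1).2]
  have h : ∀ a b : Fin 2 × Fin m, ∃ K : ℝ, 0 ≤ K ∧ ∀ᶠ n : ℕ in atTop, ∀ h : ℤ, |h| < n →
      |lagCov p C n a b h| ≤ K * (1 + |(h : ℝ)|) ^ ((p.α a.1 + p.α b.1) / 2 - 3) := by
    intro a b
    obtain ⟨s, c, h1, -⟩ := hA3.expansion a.1 b.1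
    exact exists_scaledCov_bound (hα a b) hr (hA3.even hX a.1 b.1) (hd a.1 b.1)
      (hA2.fourth_isBigO hA3 a.1 b.1) h1 _ _
  choose K hK hb using h
  refine ⟨fun a b h => K a b * (1 + |(h : ℝ)|) ^ ((p.α a.1 + p.α b.1) / 2 - 3), fun a b => ?_,
    fun a b h => mul_nonneg (hK a b) (by positivity), ?_⟩
  · exact (summable_one_add_abs_rpow (by linarith [hα a b])).mul_left _
  · exact eventually_all.2 fun a => eventually_all.2 fun b => hb a b

lemma summable_sigma0_sq (hX : IsStationaryGaussian X C P) (hA2 : CondA2 p C)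
    (hA3 : CondA3 p β₁₁ β₂₂ β₁₂ C) {m : ℕ} (a b : Fin 2 × Fin m) :
    Summable fun h : ℤ => sigma0 p a.1 b.1 (dilation a.2) (dilation b.2) h ^ 2 := by
  obtain ⟨F, hF, -, hb⟩ := exists_lagCov_bound hX hA2 hA3 m
  exact summable_sq_of_abs_le (hF a b) (abs_le_of_tendsto_of_lag_bound (tendsto_lagCov hA3 a b)
    (hb.mono fun n hn => hn a b))

end CovarianceModel

/-! ### Gaussianity and covariances of the filtered observations -/

section FilteredProcess

variable {Ω : Type*} [MeasurableSpace Ω] {P : Measure Ω} {X : Fin 2 → ℝ → Ω → ℝ}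
  {C : Fin 2 → Fin 2 → ℝ → ℝ} {p : Params}

lemma IsStationaryGaussian.memLp_two (hX : IsStationaryGaussian X C P) (i : Fin 2) (t : ℝ) :
    MemLp (X i t) 2 P :=
  (hX.gaussian.hasGaussianLaw_eval (i, t)).memLp_two

lemma IsStationaryGaussian.integral_Y (hX : IsStationaryGaussian X C P) (i : Fin 2) (u n j : ℕ) :
    ∫ ω, Y p X i u n j ω ∂P = 0 := by
  have := hX.gaussian.isProbabilityMeasure
  simp only [Y]
  rw [integral_const_mul, integral_finsetSum _ fun k _ =>
    ((hX.memLp_two i _).integrable (by norm_num)).const_mul _]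
  simp [integral_const_mul, hX.centred]

lemma IsStationaryGaussian.integral_Y_mul_Y (hX : IsStationaryGaussian X C P) (i i' : Fin 2)
    (u v n : ℕ) (hn : 0 < n) (j j' : ℕ) :
    ∫ ω, Y p X i u n j ω * Y p X i' v n j' ω ∂P
      = scaledCov ((p.α i + p.α i') / 2) (C i i') u v n ((j' : ℤ) - (j : ℤ)) := by
  have := hX.gaussian.isProbabilityMeasure
  have hn' : (0 : ℝ) < n := Nat.cast_pos.2 hn
  have hi : ∀ s t : ℝ, ∀ c : ℝ, Integrable (fun ω => c * (X i s ω * X i' t ω)) P := fun s t c =>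
    ((hX.memLp_two i s).integrable_mul (hX.memLp_two i' t)).const_mul c
  have hY : ∀ ω, Y p X i u n j ω * Y p X i' v n j' ω = (n : ℝ) ^ ((p.α i + p.α i') / 2) *
      ∑ k ∈ Finset.Icc (-1 : ℤ) 1, ∑ l ∈ Finset.Icc (-1 : ℤ) 1, filterCoeff k * filterCoeff l *
        (X i (((j : ℝ) + (k : ℝ) * (u : ℝ)) / (n : ℝ)) ω *
          X i' (((j' : ℝ) + (l : ℝ) * (v : ℝ)) / (n : ℝ)) ω) := by
    intro ω
    simp only [Y]
    rw [mul_mul_mul_comm, ← Real.rpow_add hn', Finset.sum_mul_sum]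
    congr 1
    · congr 1; ring
    · exact Finset.sum_congr rfl fun k _ => Finset.sum_congr rfl fun l _ => by ring
  simp_rw [hY]
  rw [integral_const_mul, integral_finsetSum _ fun k _ => integrable_finsetSum _ fun l _ => hi _ _ _,
    scaledCov]
  congr 1
  refine Finset.sum_congr rfl fun k _ => ?_
  rw [integral_finsetSum _ fun l _ => hi _ _ _]
  refine Finset.sum_congr rfl fun l _ => ?_
  rw [integral_const_mul, ← hX.covariance i i' (((j : ℝ) + (k : ℝ) * (u : ℝ)) / (n : ℝ))]
  congr 3
  ext ω
  congr 2
  push_cast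
  ring

omit [MeasurableSpace Ω] in
lemma Y_eq (p : Params) (X : Fin 2 → ℝ → Ω → ℝ) (i : Fin 2) (u n j : ℕ) (ω : Ω) :
    Y p X i u n j ω = (n : ℝ) ^ (p.α i / 2) * (X i (((j : ℝ) - u) / n) ω
      - 2 * X i ((j : ℝ) / n) ω + X i (((j : ℝ) + u) / n) ω) := by
  simp only [Y, sum_Icc_neg_one_one, filterCoeff]
  simp only [Int.cast_neg, Int.cast_one, Int.cast_zero, neg_mul, one_mul, zero_mul, add_zero,
    ← sub_eq_add_neg]
  congr 1
  norm_num
  ring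

lemma IsStationaryGaussian.hasGaussianLaw_Y (hX : IsStationaryGaussian X C P) {ι : Type*} [Fintype ι]
    (i : ι → Fin 2) (u j : ι → ℕ) (n : ℕ) :
    HasGaussianLaw (fun ω (a : ι) => Y p X (i a) (u a) n (j a) ω) P := by
  classical
  let q : ι → Fin 3 → Fin 2 × ℝ := fun a =>
    ![(i a, ((j a : ℝ) - u a) / n), (i a, (j a : ℝ) / n), (i a, ((j a : ℝ) + u a) / n)]
  -- Different observations may share evaluation points of `X`, so the points are collected in a
  -- finite set and each observation reads its three coordinates there.
  let I : Finset (Fin 2 × ℝ) := Finset.univ.image fun z : ι × Fin 3 => q z.1 z.2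
  have hq : ∀ a k, q a k ∈ I := fun a k => Finset.mem_image.2 ⟨(a, k), Finset.mem_univ _, rfl⟩
  let L : (I → ℝ) →L[ℝ] ι → ℝ :=
    { toFun x a := (n : ℝ) ^ (p.α (i a) / 2) *
        (x ⟨q a 0, hq a 0⟩ - 2 * x ⟨q a 1, hq a 1⟩ + x ⟨q a 2, hq a 2⟩)
      map_add' x y := by ext; simp; ring
      map_smul' c x := by ext; simp; ring }
  have h := (hX.gaussian.hasGaussianLaw I).map L
  convert! h using 1
  ext ω a
  rw [Y_eq]
  simp [L, q]

lemma IsStationaryGaussian.aemeasurable_Y (hX : IsStationaryGaussian X C P) (i : Fin 2)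
    (u n j : ℕ) : AEMeasurable (Y p X i u n j) P := by
  have := (hX.hasGaussianLaw_Y (p := p) (fun _ : Unit => i) (fun _ => u) (fun _ => j) n).eval ()
  exact this.aemeasurable

end FilteredProcess

/-! ### Central limit theorem for the quadratic variations -/

section CentralLimit

variable {Ω : Type*} [MeasurableSpace Ω] {P : Measure Ω} {X : Fin 2 → ℝ → Ω → ℝ}
  {C : Fin 2 → Fin 2 → ℝ → ℝ} {p : Params} {β₁₁ β₂₂ β₁₂ : ℝ} {m : ℕ}

/-- A linear combination of the centred and normalised quadratic variations. -/
noncomputable def quadStat (p : Params) (C : Fin 2 → Fin 2 → ℝ → ℝ) (X : Fin 2 → ℝ → Ω → ℝ)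
    (w : Fin 2 × Fin m → ℝ) (n : ℕ) (ω : Ω) : ℝ :=
  ∑ a, w a * (√(n : ℝ) * (Zbar p X a.1 (dilation a.2) n ω - lagCov p C n a a 0))

/-- Half the asymptotic variance of `quadStat`. -/
noncomputable def halfVar (p : Params) (w : Fin 2 × Fin m → ℝ) : ℝ :=
  ∑ a, ∑ b, w a * w b * ∑' h : ℤ, sigma0 p a.1 b.1 (dilation a.2) (dilation b.2) h ^ 2

/-- The covariance matrix of all filtered observations for sample size `n`. -/
noncomputable def obsCov (p : Params) (C : Fin 2 → Fin 2 → ℝ → ℝ) (m n : ℕ) :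
    Matrix ((Fin 2 × Fin m) × Fin n) ((Fin 2 × Fin m) × Fin n) ℝ :=
  Matrix.of fun z z' => lagCov p C n z.1 z'.1 ((z'.2 : ℤ) - (z.2 : ℤ))

/-- All filtered observations for sample size `n`. -/
noncomputable def obs (p : Params) (X : Fin 2 → ℝ → Ω → ℝ) (m n : ℕ)
    (z : (Fin 2 × Fin m) × Fin n) (ω : Ω) : ℝ :=
  Y p X z.1.1 (dilation z.1.2) n ((z.2 : ℕ) + 1) ω

lemma IsStationaryGaussian.integral_obs_mul_obs (hX : IsStationaryGaussian X C P) {n : ℕ}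
    (hn : 0 < n) (z z' : (Fin 2 × Fin m) × Fin n) :
    ∫ ω, obs p X m n z ω * obs p X m n z' ω ∂P = obsCov p C m n z z' := by
  simp only [obs]
  rw [hX.integral_Y_mul_Y _ _ _ _ _ hn, obsCov, Matrix.of_apply, lagCov]
  congr 1
  push_cast
  ring

omit [MeasurableSpace Ω] in
lemma quadStat_eq (w : Fin 2 × Fin m → ℝ) {n : ℕ} (hn : 0 < n) (ω : Ω) :
    quadStat p C X w n ω = ∑ z : (Fin 2 × Fin m) × Fin n,
      (w z.1 / √(n : ℝ)) * (obs p X m n z ω ^ 2 - obsCov p C m n z z) := by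
  have hn' : (0 : ℝ) < n := Nat.cast_pos.2 hn
  have hs : √(n : ℝ) ≠ 0 := (Real.sqrt_pos.2 hn').ne'
  have hss : √(n : ℝ) * √(n : ℝ) = n := Real.mul_self_sqrt hn'.le
  rw [quadStat]
  refine Eq.trans ?_ (Fintype.sum_prod_type _).symm
  refine Finset.sum_congr rfl fun a _ => ?_
  have h1 : ∑ j ∈ Finset.Icc 1 n, Y p X a.1 (dilation a.2) n j ω ^ 2
      = ∑ j : Fin n, obs p X m n (a, j) ω ^ 2 := by
    simp only [obs]
    rw [Fin.sum_univ_eq_sum_range (fun j => Y p X a.1 (dilation a.2) n (j + 1) ω ^ 2) n,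
      Finset.range_eq_Ico, Finset.sum_Ico_add' (fun j => Y p X a.1 (dilation a.2) n j ω ^ 2) 0 n 1]
    refine Finset.sum_congr ?_ fun _ _ => rfl
    ext j; simp only [Finset.mem_Icc, Finset.mem_Ico]; omega
  have h2 : ∀ j : Fin n, obsCov p C m n (a, j) (a, j) = lagCov p C n a a 0 := fun j => by
    simp [obsCov]
  simp only [h2]
  rw [Zbar, h1, ← Finset.mul_sum, Finset.sum_sub_distrib, Finset.sum_const, Finset.card_univ,
    Fintype.card_fin, nsmul_eq_mul]
  generalize ∑ j : Fin n, obs p X m n (a, j) ω ^ 2 = s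
  field_simp
  rw [sq, hss]

lemma tendsto_sum_obsCov_sq (hX : IsStationaryGaussian X C P) (hA2 : CondA2 p C)
    (hA3 : CondA3 p β₁₁ β₂₂ β₁₂ C) (w : Fin 2 × Fin m → ℝ) :
    Tendsto (fun n : ℕ => ∑ z, ∑ z', (w z.1 / √(n : ℝ)) * (w z'.1 / √(n : ℝ)) *
      obsCov p C m n z z' ^ 2) atTop (𝓝 (halfVar p w)) := by
  obtain ⟨F, hF, -, hb⟩ := exists_lagCov_bound hX hA2 hA3 m
  have h : Tendsto (fun n : ℕ => ∑ a, ∑ b, w a * w b * ((1 / (n : ℝ)) *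
      ∑ j : Fin n, ∑ k : Fin n, lagCov p C n a b ((k : ℤ) - (j : ℤ)) ^ 2)) atTop
      (𝓝 (halfVar p w)) :=
    tendsto_finsetSum _ fun a _ => tendsto_finsetSum _ fun b _ =>
      (tendsto_average_sq (hF a b) (tendsto_lagCov hA3 a b)
        (hb.mono fun n hn => hn a b)).const_mul _
  refine h.congr fun n => ?_
  have hss : √(n : ℝ) * √(n : ℝ) = n := Real.mul_self_sqrt (Nat.cast_nonneg n)
  have hp : ∀ g : (Fin 2 × Fin m) × Fin n → ℝ, ∑ z, g z = ∑ a, ∑ j, g (a, j) := fun g =>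
    Fintype.sum_prod_type g
  simp only [hp]
  refine Finset.sum_congr rfl fun a _ => ?_
  rw [Finset.sum_comm]
  refine Finset.sum_congr rfl fun b _ => ?_
  simp only [Finset.mul_sum]
  refine Finset.sum_congr rfl fun j _ => Finset.sum_congr rfl fun k _ => ?_
  rw [div_mul_div_comm, hss, obsCov, Matrix.of_apply]
  ring

/-- The summable envelope bounds the row sums of covariances, so the weights leave `O(n ^ (-1/2))`.
This plays the role of a Lindeberg condition: no single `l_k` contributes in the limit. -/
lemma eventually_row_sum_le (hX : IsStationaryGaussian X C P) (hA2 : CondA2 p C)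
    (hA3 : CondA3 p β₁₁ β₂₂ β₁₂ C) (w : Fin 2 × Fin m → ℝ) {δ : ℝ} (hδ : 0 < δ) :
    ∀ᶠ n : ℕ in atTop, ∀ z : (Fin 2 × Fin m) × Fin n,
      ∑ z', |(w z.1 / √(n : ℝ)) * obsCov p C m n z z'| ≤ δ := by
  obtain ⟨F, hF, hF0, hb⟩ := exists_lagCov_bound hX hA2 hA3 m
  have ht : Tendsto (fun n : ℕ => (√(n : ℝ))⁻¹) atTop (𝓝 0) :=
    tendsto_inv_atTop_zero.comp (Real.tendsto_sqrt_atTop.comp tendsto_natCast_atTop_atTop)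
  have he : ∀ᶠ n : ℕ in atTop, ∀ a, (|w a| * ∑ b, ∑' h, F a b h) * (√(n : ℝ))⁻¹ < δ := by
    refine eventually_all.2 fun a => ?_
    have := ht.const_mul (|w a| * ∑ b, ∑' h, F a b h)
    rw [mul_zero] at this
    exact this.eventually (eventually_lt_nhds hδ)
  filter_upwards [hb, he] with n hn hnδ z
  refine le_trans ?_ (hnδ z.1).le
  rw [Fintype.sum_prod_type]
  calc ∑ b, ∑ k : Fin n, |w z.1 / √(n : ℝ) * obsCov p C m n z (b, k)|
      = ∑ b, (|w z.1| * (√(n : ℝ))⁻¹) *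
          ∑ k : Fin n, |lagCov p C n z.1 b ((k : ℤ) - (z.2 : ℤ))| := by
        simp only [Finset.mul_sum]
        refine Finset.sum_congr rfl fun b _ => Finset.sum_congr rfl fun k _ => ?_
        rw [abs_mul, abs_div, abs_of_nonneg (Real.sqrt_nonneg _), div_eq_mul_inv, obsCov,
          Matrix.of_apply]
    _ ≤ ∑ b, (|w z.1| * (√(n : ℝ))⁻¹) * ∑' h, F z.1 b h := by
        gcongr with b
        exact sum_abs_lag_le_tsum (hF z.1 b) (hF0 z.1 b) (hn z.1 b) z.2
    _ = _ := by rw [← Finset.mul_sum]; ring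

lemma tendsto_integral_quadStat_sq (hX : IsStationaryGaussian X C P) (hA2 : CondA2 p C)
    (hA3 : CondA3 p β₁₁ β₂₂ β₁₂ C) (w : Fin 2 × Fin m → ℝ) :
    Tendsto (fun n : ℕ => ∫ ω, quadStat p C X w n ω ^ 2 ∂P) atTop (𝓝 (2 * halfVar p w)) := by
  refine ((tendsto_sum_obsCov_sq hX hA2 hA3 w).const_mul 2).congr' ?_
  filter_upwards [eventually_gt_atTop 0] with n hn
  simp_rw [quadStat_eq w hn]
  exact (integral_sq_weighted_sum_sq (hX.hasGaussianLaw_Y _ _ _ n) (fun z => hX.integral_Y _ _ _ _)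
    (fun z z' => hX.integral_obs_mul_obs hn z z') fun z => w z.1 / √(n : ℝ)).symm

/-- Twice this quantity is a limit of second moments. -/
lemma halfVar_nonneg (hX : IsStationaryGaussian X C P) (hA2 : CondA2 p C)
    (hA3 : CondA3 p β₁₁ β₂₂ β₁₂ C) (w : Fin 2 × Fin m → ℝ) : 0 ≤ halfVar p w := by
  have h := ge_of_tendsto' (tendsto_integral_quadStat_sq hX hA2 hA3 w) fun n =>
    integral_nonneg fun ω => sq_nonneg _
  linarith

/-- Central limit theorem for the quadratic variations, in terms of characteristic functions. -/
lemma tendsto_charFun_quadStat (hX : IsStationaryGaussian X C P) (hA2 : CondA2 p C)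
    (hA3 : CondA3 p β₁₁ β₂₂ β₁₂ C) (w : Fin 2 × Fin m → ℝ) :
    Tendsto (fun n : ℕ => ∫ ω, Complex.exp ((quadStat p C X w n ω : ℂ) * Complex.I) ∂P) atTop
      (𝓝 (Complex.exp (-((halfVar p w : ℝ) : ℂ)))) := by
  have hV := tendsto_sum_obsCov_sq hX hA2 hA3 w
  set V : ℕ → ℝ := fun n => ∑ z, ∑ z', (w z.1 / √(n : ℝ)) * (w z'.1 / √(n : ℝ)) *
      obsCov p C m n z z' ^ 2 with hVdef
  have hexp : Tendsto (fun n => Complex.exp (-((V n : ℝ) : ℂ))) atTop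
      (𝓝 (Complex.exp (-((halfVar p w : ℝ) : ℂ)))) := by
    have hc : Continuous fun x : ℝ => Complex.exp (-(x : ℂ)) := by fun_prop
    exact (hc.tendsto _).comp hV
  have hdiff : Tendsto (fun n : ℕ =>
      (∫ ω, Complex.exp ((quadStat p C X w n ω : ℂ) * Complex.I) ∂P)
        - Complex.exp (-((V n : ℝ) : ℂ))) atTop (𝓝 0) := by
    rw [Metric.tendsto_atTop']
    suffices h : ∀ ε > 0, ∀ᶠ n : ℕ in atTop,
        ‖(∫ ω, Complex.exp ((quadStat p C X w n ω : ℂ) * Complex.I) ∂P)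
          - Complex.exp (-((V n : ℝ) : ℂ))‖ < ε by
      intro ε hε
      obtain ⟨N, hN⟩ := eventually_atTop.1 (h ε hε)
      exact ⟨N, fun n hn => by rw [dist_zero_right]; exact hN n hn.le⟩
    intro ε hε
    have h0 := halfVar_nonneg hX hA2 hA3 w
    -- The approximation error is at most `ε' * V n`, and eventually `V n < halfVar p w + 1`.
    set ε' := ε / (halfVar p w + 1) with hε'
    have hε'0 : 0 < ε' := by positivity
    obtain ⟨δ, hδ, hb⟩ := exists_charFun_weighted_sum_sq_bound hε'0
    filter_upwards [eventually_gt_atTop 0, eventually_row_sum_le hX hA2 hA3 w hδ,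
      hV.eventually (eventually_lt_nhds (lt_add_one _))] with n hn hrow hVn
    simp_rw [quadStat_eq w hn]
    refine (hb (hX.hasGaussianLaw_Y _ _ _ n) (fun z => hX.integral_Y _ _ _ _)
      (fun z z' => hX.integral_obs_mul_obs hn z z') (fun z => w z.1 / √(n : ℝ)) hrow).trans_lt ?_
    calc ε' * V n < ε' * (halfVar p w + 1) := by gcongr
      _ = ε := by rw [hε']; field_simp
  have := hdiff.add hexp
  simpa using this

end CentralLimit

/-! ### Linearization of the logarithm and convergence in probability -/

section DeltaMethod

lemma abs_log_one_add_sub_le {x : ℝ} (hx : |x| ≤ 1 / 2) : |Real.log (1 + x) - x| ≤ 2 * x ^ 2 := by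
  have h := Real.abs_log_sub_add_sum_range_le (x := -x) (by rw [abs_neg]; linarith) 1
  simp only [Finset.sum_range_one, sub_neg_eq_add, abs_neg] at h
  norm_num at h
  rw [neg_add_eq_sub] at h
  refine h.trans ?_
  rw [div_le_iff₀ (by linarith)]
  nlinarith [sq_nonneg x]

variable {Ω : Type*} [MeasurableSpace Ω] {P : Measure Ω} [IsProbabilityMeasure P]

/-- The delta method for the logarithm at rate `√n`, with an explicit linearization. -/
lemma tendstoInMeasure_log_sub_linear {W : ℕ → Ω → ℝ} {e : ℕ → ℝ} {τ K : ℝ} (hτ : 0 < τ)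
    (he : Tendsto (fun n : ℕ => √(n : ℝ) * (e n - τ)) atTop (𝓝 0))
    (hint : ∀ᶠ n : ℕ in atTop, Integrable (fun ω => (√(n : ℝ) * (W n ω - e n)) ^ 2) P)
    (hK : ∀ᶠ n : ℕ in atTop, ∫ ω, (√(n : ℝ) * (W n ω - e n)) ^ 2 ∂P ≤ K) :
    TendstoInMeasure P (fun (n : ℕ) ω => √(n : ℝ) * (Real.log (W n ω) - Real.log τ)
      - √(n : ℝ) * (W n ω - e n) / τ) atTop 0 := by
  rw [tendstoInMeasure_iff_measureReal_norm]
  intro ε hε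
  -- On the event `D ^ 2 < c * s`, the fluctuation contributes at most `2 * c / τ ^ 2 = ε / 8` to `s
  -- * x ^ 2`, where `x` is the relative error. By Markov's inequality the complement has
  -- probability at most `K / (c * s)`.
  set c := ε * τ ^ 2 / 16 with hc
  have hcpos : 0 < c := by positivity
  have hs : Tendsto (fun n : ℕ => √(n : ℝ)) atTop atTop :=
    Real.tendsto_sqrt_atTop.comp tendsto_natCast_atTop_atTop
  have hsi : Tendsto (fun n : ℕ => (√(n : ℝ))⁻¹) atTop (𝓝 0) := tendsto_inv_atTop_zero.comp hs
  have hmaj : Tendsto (fun n : ℕ => K / c * (√(n : ℝ))⁻¹) atTop (𝓝 0) := by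
    simpa using hsi.const_mul (K / c)
  refine squeeze_zero' (Eventually.of_forall fun n => measureReal_nonneg) ?_ hmaj
  have h1 : ∀ᶠ n : ℕ in atTop, |√(n : ℝ) * (e n - τ)| / τ < ε / 4 := by
    have := he.abs.div_const τ
    rw [abs_zero, zero_div] at this
    exact this.eventually (eventually_lt_nhds (by positivity))
  have h2 : ∀ᶠ n : ℕ in atTop, 2 * (√(n : ℝ) * (e n - τ)) ^ 2 * (√(n : ℝ))⁻¹ / τ ^ 2 < ε / 8 := by
    have := ((((he.pow 2).const_mul 2).mul hsi)).div_const (τ ^ 2)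
    simp only [mul_zero, zero_div] at this
    exact this.eventually (eventually_lt_nhds (by positivity))
  have h3 : ∀ᶠ n : ℕ in atTop, ε / 4 * (√(n : ℝ))⁻¹ < 1 / 4 := by
    have := hsi.const_mul (ε / 4)
    rw [mul_zero] at this
    exact this.eventually (eventually_lt_nhds (by norm_num))
  filter_upwards [h1, h2, h3, hint, hK, eventually_gt_atTop 0] with n h1 h2 h3 hint hK hn
  have hn' : (0 : ℝ) < n := Nat.cast_pos.2 hn
  set s := √(n : ℝ) with hsdef
  have hspos : 0 < s := Real.sqrt_pos.2 hn'
  have hsub : {ω | ε ≤ ‖s * (Real.log (W n ω) - Real.log τ) - s * (W n ω - e n) / τ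
      - (0 : Ω → ℝ) ω‖} ⊆ {ω | c * s ≤ (s * (W n ω - e n)) ^ 2} := by
    intro ω hω
    by_contra hlt
    rw [Set.mem_ofPred_eq, not_le] at hlt
    rw [Set.mem_ofPred_eq, Pi.zero_apply, sub_zero, Real.norm_eq_abs] at hω
    refine absurd hω (not_le.2 ?_)
    set D := s * (W n ω - e n) with hD
    set E := s * (e n - τ) with hE
    set x := (W n ω - τ) / τ with hx
    have hxs : s * x = (D + E) / τ := by rw [hx, hD, hE]; field_simp; ring
    have hsx : s * x ^ 2 < ε / 4 := by
      have e1 : s * x ^ 2 = (D + E) ^ 2 * s⁻¹ / τ ^ 2 := by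
        have : s * x ^ 2 = (s * x) ^ 2 * s⁻¹ := by field_simp
        rw [this, hxs]; ring
      have e2 : (D + E) ^ 2 * s⁻¹ / τ ^ 2 ≤ 2 * D ^ 2 * s⁻¹ / τ ^ 2 + 2 * E ^ 2 * s⁻¹ / τ ^ 2 := by
        rw [← add_div, ← add_mul]
        gcongr
        nlinarith [sq_nonneg (D - E)]
      have e3 : 2 * D ^ 2 * s⁻¹ / τ ^ 2 ≤ ε / 8 := by
        have : 2 * D ^ 2 * s⁻¹ / τ ^ 2 ≤ 2 * (c * s) * s⁻¹ / τ ^ 2 := by gcongr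
        refine this.trans_eq ?_
        rw [hc]; field_simp; norm_num
      rw [e1]; linarith
    -- Here `1 + x > 0`, so `W n ω` is positive and the convention for the logarithm at nonpositive
    -- arguments plays no role.
    have hx2 : |x| ≤ 1 / 2 := by
      refine abs_le_of_sq_le_sq ?_ (by norm_num)
      have : x ^ 2 = s * x ^ 2 * s⁻¹ := by field_simp
      have h4 : s * x ^ 2 * s⁻¹ ≤ ε / 4 * s⁻¹ := by gcongr
      rw [this]; linarith
    have hWx : W n ω = τ * (1 + x) := by rw [hx]; field_simp; ring
    have hlog : Real.log (W n ω) - Real.log τ = Real.log (1 + x) := by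
      rw [hWx, Real.log_mul hτ.ne' (by linarith [(abs_le.1 hx2).1])]; ring
    have hdec : s * (Real.log (W n ω) - Real.log τ) - D / τ
        = s * (Real.log (1 + x) - x) + E / τ := by
      rw [hlog, mul_sub, hxs]; ring
    rw [hdec]
    calc |s * (Real.log (1 + x) - x) + E / τ|
        ≤ |s * (Real.log (1 + x) - x)| + |E / τ| := abs_add_le _ _
      _ = s * |Real.log (1 + x) - x| + |E| / τ := by
          rw [abs_mul, abs_div, abs_of_pos hspos, abs_of_pos hτ]
      _ ≤ s * (2 * x ^ 2) + |E| / τ := by gcongr; exact abs_log_one_add_sub_le hx2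
      _ < ε := by linarith
  have hmk := mul_meas_ge_le_integral_of_nonneg (μ := P)
    (Eventually.of_forall fun ω => sq_nonneg (s * (W n ω - e n))) hint (c * s)
  calc P.real _ ≤ P.real {ω | c * s ≤ (s * (W n ω - e n)) ^ 2} := measureReal_mono hsub
    _ ≤ K / (c * s) := by
        rw [le_div_iff₀ (by positivity), mul_comm]
        exact hmk.trans hK
    _ = K / c * s⁻¹ := by field_simp

lemma tendstoInMeasure_finsetSum_const_mul {κ : Type*} (s : Finset κ) (c : κ → ℝ)
    {f : κ → ℕ → Ω → ℝ} (hf : ∀ k ∈ s, TendstoInMeasure P (f k) atTop 0) :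
    TendstoInMeasure P (fun n ω => ∑ k ∈ s, c k * f k n ω) atTop 0 := by
  rw [tendstoInMeasure_iff_measureReal_norm]
  intro ε hε
  set M := ∑ k ∈ s, |c k| with hM
  have hM0 : 0 ≤ M := Finset.sum_nonneg fun _ _ => abs_nonneg _
  have hη : 0 < ε / (M + 1) := by positivity
  have h : Tendsto (fun n => ∑ k ∈ s, P.real {ω | ε / (M + 1) ≤ ‖f k n ω - (0 : Ω → ℝ) ω‖}) atTop
      (𝓝 0) := by
    rw [show (0 : ℝ) = ∑ k ∈ s, 0 by simp]
    exact tendsto_finsetSum _ fun k hk =>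
      tendstoInMeasure_iff_measureReal_norm.1 (hf k hk) _ hη
  refine squeeze_zero (fun n => measureReal_nonneg) (fun n => ?_) h
  refine (measureReal_mono ?_ (measure_ne_top P _)).trans (measureReal_biUnion_finset_le s _)
  intro ω hω
  by_contra hcon
  simp only [Set.mem_iUnion, Set.mem_ofPred_eq, not_exists, not_le, Pi.zero_apply, sub_zero,
    Real.norm_eq_abs] at hcon hω
  refine absurd hω (not_le.2 ?_)
  calc |∑ k ∈ s, c k * f k n ω| ≤ ∑ k ∈ s, |c k * f k n ω| := Finset.abs_sum_le_sum_abs _ _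
    _ ≤ ∑ k ∈ s, |c k| * (ε / (M + 1)) := Finset.sum_le_sum fun k hk => by
        rw [abs_mul]; exact mul_le_mul_of_nonneg_left (hcon k hk).le (abs_nonneg _)
    _ = ε * (M / (M + 1)) := by rw [← Finset.sum_mul, ← hM]; ring
    _ < ε * 1 := by
        gcongr
        rw [div_lt_one (by linarith)]; linarith
    _ = ε := mul_one ε

lemma tendstoInMeasure_euclideanSpace_two {R : ℕ → Ω → EuclideanSpace ℝ (Fin 2)}
    (h : ∀ i, TendstoInMeasure P (fun n ω => R n ω i) atTop 0) : TendstoInMeasure P R atTop 0 := by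
  rw [tendstoInMeasure_iff_measureReal_norm]
  intro ε hε
  have hlim : Tendsto (fun n => ∑ i : Fin 2, P.real {ω | ε / 2 ≤ ‖R n ω i - (0 : Ω → ℝ) ω‖}) atTop
      (𝓝 0) := by
    rw [show (0 : ℝ) = ∑ i : Fin 2, 0 by simp]
    exact tendsto_finsetSum _ fun i _ =>
      tendstoInMeasure_iff_measureReal_norm.1 (h i) _ (half_pos hε)
  refine squeeze_zero (fun n => measureReal_nonneg) (fun n => ?_) hlim
  refine (measureReal_mono ?_ (measure_ne_top P _)).trans (measureReal_biUnion_finset_le Finset.univ _)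
  intro ω hω
  by_contra hcon
  simp only [Set.mem_iUnion, Set.mem_ofPred_eq, not_exists, not_le, Pi.zero_apply, sub_zero,
    Real.norm_eq_abs, Finset.mem_univ, true_implies] at hcon hω
  refine absurd hω (not_le.2 ?_)
  have h0 := hcon 0
  have h1 := hcon 1
  rw [EuclideanSpace.norm_eq, Fin.sum_univ_two, Real.sqrt_lt' hε, Real.norm_eq_abs,
    Real.norm_eq_abs]
  nlinarith [abs_nonneg (R n ω 0), abs_nonneg (R n ω 1)]

end DeltaMethod

/-! ### The limiting covariance matrix -/

section LimitCovariance

variable {Ω : Type*} [MeasurableSpace Ω] {P : Measure Ω} {X : Fin 2 → ℝ → Ω → ℝ}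
  {C : Fin 2 → Fin 2 → ℝ → ℝ} {p : Params} {β₁₁ β₂₂ β₁₂ : ℝ} {m : ℕ}

lemma sigma0_neg_swap (p : Params) (i j : Fin 2) (u v : ℕ) (h : ℤ) :
    sigma0 p j i v u (-h) = sigma0 p i j u v h := by
  simp only [sigma0, filteredPower_neg_swap, eq_comm (a := j)]
  by_cases hij : i = j
  · rw [if_pos hij, if_pos hij, hij]
  · rw [if_neg hij, if_neg hij]

/-- Exchanging the two processes reverses the lag, and the sum over `ℤ` is invariant under `h ↦ -h`.
-/
lemma Phi0_swap (p : Params) (i j : Fin 2) (u v : Fin m) : Phi0 p m j i v u = Phi0 p m i j u v := by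
  simp only [Phi0, Matrix.of_apply]
  rw [← (Equiv.neg ℤ).tsum_eq]
  simp only [Equiv.neg_apply, sigma0_neg_swap]

/-- The weights of the quadratic variations in the linearization of a combination of estimators. -/
noncomputable def linWeight (p : Params) (L : Fin 2 → Fin m → ℝ) (t : Fin 2 → ℝ) :
    Fin 2 × Fin m → ℝ :=
  fun a => t a.1 * Ltilde p L a.1 a.2

lemma dotProduct_limitCov_mulVec (p : Params) (L : Fin 2 → Fin m → ℝ) (t : Fin 2 → ℝ) :
    t ⬝ᵥ limitCov p L *ᵥ t = 2 * halfVar p (linWeight p L t) := by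
  simp only [halfVar, linWeight, Fintype.sum_prod_type, dotProduct, Matrix.mulVec, limitCov,
    Matrix.of_apply, Phi0, Finset.mul_sum, Finset.sum_mul]
  refine Finset.sum_congr rfl fun i _ => ?_
  rw [Finset.sum_comm]
  refine Finset.sum_congr rfl fun u _ => Finset.sum_congr rfl fun j _ =>
    Finset.sum_congr rfl fun v _ => ?_
  ring

lemma posSemidef_limitCov (hX : IsStationaryGaussian X C P) (hA2 : CondA2 p C)
    (hA3 : CondA3 p β₁₁ β₂₂ β₁₂ C) (L : Fin 2 → Fin m → ℝ) : (limitCov p L).PosSemidef := by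
  refine Matrix.PosSemidef.of_dotProduct_mulVec_nonneg ?_ fun t => ?_
  · rw [Matrix.IsHermitian, Matrix.conjTranspose_eq_transpose_of_trivial]
    ext i j
    simp only [Matrix.transpose_apply, limitCov, Matrix.of_apply, dotProduct, Matrix.mulVec,
      Finset.mul_sum]
    rw [Finset.sum_comm]
    refine Finset.sum_congr rfl fun u _ => Finset.sum_congr rfl fun v _ => ?_
    rw [Phi0_swap]
    ring
  · rw [star_trivial, dotProduct_limitCov_mulVec]
    exact mul_nonneg zero_le_two (halfVar_nonneg hX hA2 hA3 _)

lemma limitCov_cross_eq_zero (h : (p.α₁₁ + p.α₂₂) / 2 < p.α₁₂) (L : Fin 2 → Fin m → ℝ) :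
    limitCov p L 0 1 = 0 := by
  have h0 : Phi0 p m 0 1 = 0 := by
    ext u v
    simp [Phi0, sigma0, h]
  simp [limitCov, h0]

end LimitCovariance

/-! ### Asymptotic law of the estimators -/

section Estimator

variable {Ω : Type*} [MeasurableSpace Ω] {P : Measure Ω} {X : Fin 2 → ℝ → Ω → ℝ}
  {C : Fin 2 → Fin 2 → ℝ → ℝ} {p : Params} {β₁₁ β₂₂ β₁₂ : ℝ} {m : ℕ}

lemma dilation_pos (u : Fin m) : (0 : ℝ) < dilation u := by
  simp only [dilation]; positivity

lemma CondA3.tau_const_pos (hA3 : CondA3 p β₁₁ β₂₂ β₁₂ C) (i : Fin 2) :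
    0 < p.c i * (8 - (2 : ℝ) ^ (p.α i + 1)) := by
  refine mul_pos (hA3.c_pos i) (sub_pos.2 ?_)
  calc (2 : ℝ) ^ (p.α i + 1) < 2 ^ (3 : ℝ) :=
        Real.rpow_lt_rpow_of_exponent_lt (by norm_num) (by linarith [(hA3.α_mem i).2])
    _ = 8 := by norm_num

lemma CondA3.tau_pos (hA3 : CondA3 p β₁₁ β₂₂ β₁₂ C) (i : Fin 2) (u : Fin m) :
    0 < tau p i (dilation u) :=
  mul_pos (hA3.tau_const_pos i) (Real.rpow_pos_of_pos (dilation_pos u) _)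

/-- As `log tau` is a constant plus `α * log u`, the condition `∑ L = 0` removes the constant and `∑
L log u = 1` extracts `α`. -/
lemma sum_weight_mul_log_tau (hA3 : CondA3 p β₁₁ β₂₂ β₁₂ C) {L : Fin 2 → Fin m → ℝ}
    (hL : IsWeight L) (i : Fin 2) : ∑ u, L i u * Real.log (tau p i (dilation u)) = p.α i := by
  have h : ∀ u : Fin m, L i u * Real.log (tau p i (dilation u))
      = L i u * Real.log (p.c i * (8 - (2 : ℝ) ^ (p.α i + 1)))
        + p.α i * (L i u * Real.log (dilation u : ℝ)) := by
    intro u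
    rw [tau, Real.log_mul (hA3.tau_const_pos i).ne' (Real.rpow_pos_of_pos (dilation_pos u) _).ne',
      Real.log_rpow (dilation_pos u)]
    ring
  simp_rw [h]
  rw [Finset.sum_add_distrib, ← Finset.sum_mul, ← Finset.mul_sum, (hL i).1, (hL i).2]
  ring

lemma tendsto_sqrt_mul_mean_sub_tau (hA3 : CondA3 p β₁₁ β₂₂ β₁₂ C) (hβ₁₁ : 1 / 2 < β₁₁)
    (hβ₂₂ : 1 / 2 < β₂₂) (a : Fin 2 × Fin m) :
    Tendsto (fun n : ℕ => √(n : ℝ) * (lagCov p C n a a 0 - tau p a.1 (dilation a.2))) atTop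
      (𝓝 0) := by
  have key : ∀ (i : Fin 2) (s β : ℝ), 1 / 2 < β →
      ((fun t => C i i t - (s - p.c i * |t| ^ p.α i)) =O[𝓝 0] fun t : ℝ => |t| ^ (p.α i + β)) →
      ∀ u : Fin m, Tendsto (fun n : ℕ => √(n : ℝ) * (lagCov p C n (i, u) (i, u) 0
        - tau p i (dilation u))) atTop (𝓝 0) := by
    intro i s β hβ h u
    have hα := (hA3.α_mem i).1
    have h1 := tendsto_sqrt_mul_scaledCov_sub hα hβ h (dilation u) (dilation u) 0
    have h2 : -p.c i * filteredPower (p.α i) (dilation u) (dilation u) 0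
        = tau p i (dilation u) := by
      rw [filteredPower_self_zero hα, tau, Real.rpow_add_one (by norm_num)]
      ring
    rw [h2] at h1
    simpa only [lagCov, add_self_div_two] using h1
  obtain ⟨i, u⟩ := a
  fin_cases i
  · exact key 0 _ _ hβ₁₁ hA3.expansion₁₁ u
  · exact key 1 _ _ hβ₂₂ hA3.expansion₂₂ u

lemma IsStationaryGaussian.aemeasurable_Zbar (hX : IsStationaryGaussian X C P) (i : Fin 2)
    (u n : ℕ) : AEMeasurable (Zbar p X i u n) P :=
  (Finset.aemeasurable_fun_sum _ fun j _ => (hX.aemeasurable_Y i u n j).pow_const 2).const_mul _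

lemma IsStationaryGaussian.memLp_Zbar (hX : IsStationaryGaussian X C P) (i : Fin 2)
    (u n : ℕ) : MemLp (Zbar p X i u n) 2 P := by
  have := hX.gaussian.isProbabilityMeasure
  have hY : ∀ j, MemLp (fun ω => Y p X i u n j ω ^ 2) 2 P := by
    intro j
    have hm := hX.aemeasurable_Y (p := p) i u n j
    rw [memLp_two_iff_integrable_sq (hm.pow_const 2).aestronglyMeasurable]
    have hg := (hX.hasGaussianLaw_Y (p := p) (fun _ : Unit => i) (fun _ => u) (fun _ => j) n).eval ()
    have h4 := (hg.memLp (p := (4 : ℕ)) (by simp)).integrable_norm_pow'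
    refine h4.congr (Eventually.of_forall fun ω => ?_)
    simp only [Real.norm_eq_abs]
    rw [← pow_mul, ← abs_pow, abs_of_nonneg (by positivity)]
  exact (memLp_finsetSum _ fun j _ => hY j).const_mul _

lemma tendstoInMeasure_log_Zbar (hX : IsStationaryGaussian X C P) (hA2 : CondA2 p C)
    (hA3 : CondA3 p β₁₁ β₂₂ β₁₂ C) (hβ₁₁ : 1 / 2 < β₁₁) (hβ₂₂ : 1 / 2 < β₂₂)
    (a : Fin 2 × Fin m) :
    TendstoInMeasure P (fun (n : ℕ) ω => √(n : ℝ) *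
        (Real.log (Zbar p X a.1 (dilation a.2) n ω) - Real.log (tau p a.1 (dilation a.2)))
      - √(n : ℝ) * (Zbar p X a.1 (dilation a.2) n ω - lagCov p C n a a 0)
        / tau p a.1 (dilation a.2)) atTop 0 := by
  have := hX.gaussian.isProbabilityMeasure
  -- The unit weight isolates a single quadratic variation; its convergent second moments supply the
  -- bound required by the delta method.
  have h2 := tendsto_integral_quadStat_sq hX hA2 hA3 (Pi.single a 1)
  have hq : ∀ (n : ℕ) (ω : Ω), quadStat p C X (Pi.single a 1) n ω
      = √(n : ℝ) * (Zbar p X a.1 (dilation a.2) n ω - lagCov p C n a a 0) := fun n ω => by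
    rw [quadStat, Finset.sum_eq_single a (fun b _ hb => by rw [Pi.single_eq_of_ne hb, zero_mul])
      (fun h => absurd (Finset.mem_univ a) h), Pi.single_eq_same, one_mul]
  simp_rw [hq] at h2
  refine tendstoInMeasure_log_sub_linear (hA3.tau_pos a.1 a.2)
    (tendsto_sqrt_mul_mean_sub_tau hA3 hβ₁₁ hβ₂₂ a) (Eventually.of_forall fun n => ?_)
    (h2.eventually (eventually_le_nhds (lt_add_one _)))
  exact (((hX.memLp_Zbar a.1 (dilation a.2) n).sub (memLp_const _)).const_mul _).integrable_sq

/-- The linearization of the pair of estimators. -/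
noncomputable def linStat (p : Params) (C : Fin 2 → Fin 2 → ℝ → ℝ) (X : Fin 2 → ℝ → Ω → ℝ)
    (L : Fin 2 → Fin m → ℝ) (n : ℕ) (ω : Ω) : EuclideanSpace ℝ (Fin 2) :=
  WithLp.toLp 2 fun i => ∑ u, Ltilde p L i u *
    (√(n : ℝ) * (Zbar p X i (dilation u) n ω - lagCov p C n (i, u) (i, u) 0))

lemma aemeasurable_linStat (hX : IsStationaryGaussian X C P) (L : Fin 2 → Fin m → ℝ) (n : ℕ) :
    AEMeasurable (linStat p C X L n) P := by
  have h : AEMeasurable (fun ω i => ∑ u, Ltilde p L i u *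
      (√(n : ℝ) * (Zbar p X i (dilation u) n ω - lagCov p C n (i, u) (i, u) 0))) P :=
    aemeasurable_pi_lambda _ fun i => Finset.aemeasurable_fun_sum _ fun u _ =>
      (((hX.aemeasurable_Zbar i (dilation u) n).sub_const _).const_mul _).const_mul _
  exact (WithLp.measurable_toLp 2 (Fin 2 → ℝ)).comp_aemeasurable h

omit [MeasurableSpace Ω] in
lemma inner_linStat (L : Fin 2 → Fin m → ℝ) (n : ℕ) (ω : Ω) (t : EuclideanSpace ℝ (Fin 2)) :
    inner ℝ (linStat p C X L n ω) t = quadStat p C X (linWeight p L t) n ω := by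
  rw [PiLp.inner_apply, quadStat, Fintype.sum_prod_type]
  refine Finset.sum_congr rfl fun i _ => ?_
  simp only [linStat, linWeight, RCLike.inner_apply, conj_trivial, Finset.mul_sum]
  exact Finset.sum_congr rfl fun u _ => by ring

/-- By Lévy's continuity theorem, it suffices to treat each scalar projection `inner ℝ (linStat ..)
t`, which is a `quadStat` covered by the scalar limit theorem. -/
lemma tendstoInDistribution_linStat [IsProbabilityMeasure P] (hX : IsStationaryGaussian X C P)
    (hA2 : CondA2 p C) (hA3 : CondA3 p β₁₁ β₂₂ β₁₂ C) (L : Fin 2 → Fin m → ℝ) :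
    TendstoInDistribution (linStat p C X L) atTop
      (id : EuclideanSpace ℝ (Fin 2) → EuclideanSpace ℝ (Fin 2)) (fun _ => P)
      (multivariateGaussian 0 (limitCov p L)) where
  forall_aemeasurable n := aemeasurable_linStat hX L n
  tendsto := by
    refine ProbabilityMeasure.tendsto_iff_tendsto_charFun.2 fun t => ?_
    have hlim : charFun ((multivariateGaussian 0 (limitCov p L)).map id) t
        = Complex.exp (-((halfVar p (linWeight p L t) : ℝ) : ℂ)) := by
      rw [Measure.map_id, charFun_multivariateGaussian (posSemidef_limitCov hX hA2 hA3 L),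
        dotProduct_limitCov_mulVec]
      congr 1
      simp
    simp only [ProbabilityMeasure.coe_mk]
    rw [hlim]
    refine (tendsto_charFun_quadStat hX hA2 hA3 (linWeight p L t)).congr fun n => ?_
    rw [charFun_apply, integral_map (aemeasurable_linStat hX L n)
      (Continuous.aestronglyMeasurable (by fun_prop))]
    simp_rw [inner_linStat]

/-- Slutsky's theorem: the estimators differ from `linStat` by a weighted sum of logarithmic
remainders that tends to zero in probability. -/
lemma tendstoInDistribution_alphaHat [IsProbabilityMeasure P] (hX : IsStationaryGaussian X C P)
    (hA2 : CondA2 p C) (hA3 : CondA3 p β₁₁ β₂₂ β₁₂ C) (hβ₁₁ : 1 / 2 < β₁₁) (hβ₂₂ : 1 / 2 < β₂₂)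
    {L : Fin 2 → Fin m → ℝ} (hL : IsWeight L) :
    TendstoInDistribution
      (fun (n : ℕ) (ω : Ω) => !₂[√(n : ℝ) * (alphaHat p L X 0 n ω - p.α₁₁),
        √(n : ℝ) * (alphaHat p L X 1 n ω - p.α₂₂)])
      atTop (id : EuclideanSpace ℝ (Fin 2) → EuclideanSpace ℝ (Fin 2)) (fun _ => P)
      (multivariateGaussian 0 (limitCov p L)) := by
  have hS : (fun (n : ℕ) (ω : Ω) => !₂[√(n : ℝ) * (alphaHat p L X 0 n ω - p.α₁₁),
        √(n : ℝ) * (alphaHat p L X 1 n ω - p.α₂₂)])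
      = fun (n : ℕ) ω => WithLp.toLp 2 fun i => √(n : ℝ) * (alphaHat p L X i n ω - p.α i) := by
    ext n ω i
    fin_cases i <;> rfl
  rw [hS]
  refine tendstoInDistribution_of_tendstoInMeasure_sub _ _
    (tendstoInDistribution_linStat hX hA2 hA3 L) (tendstoInMeasure_euclideanSpace_two fun i => ?_)
    fun n => ?_
  · have h := tendstoInMeasure_finsetSum_const_mul Finset.univ (L i) fun u _ =>
      tendstoInMeasure_log_Zbar hX hA2 hA3 hβ₁₁ hβ₂₂ (i, u)
    convert! h using 3 with n ω
    simp only [Pi.sub_apply, PiLp.sub_apply, linStat, alphaHat]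
    rw [← sum_weight_mul_log_tau hA3 hL i, ← Finset.sum_sub_distrib, Finset.mul_sum,
      ← Finset.sum_sub_distrib]
    refine Finset.sum_congr rfl fun u _ => ?_
    rw [Ltilde]
    ring
  · have h : AEMeasurable (fun ω i => √(n : ℝ) * (alphaHat p L X i n ω - p.α i)) P :=
      aemeasurable_pi_lambda _ fun i => ((Finset.aemeasurable_fun_sum _ fun u _ =>
        ((Real.measurable_log.comp_aemeasurable
          (hX.aemeasurable_Zbar i (dilation u) n)).const_mul _)).sub_const _).const_mul _
    exact (WithLp.measurable_toLp 2 (Fin 2 → ℝ)).comp_aemeasurable h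

/-- The coordinates of a centred bivariate Gaussian law with zero cross covariance are
independent. -/
lemma map_coords_multivariateGaussian {S : Matrix (Fin 2) (Fin 2) ℝ} (hS : S.PosSemidef)
    (h : S 0 1 = 0) :
    (multivariateGaussian 0 S).map (fun x : EuclideanSpace ℝ (Fin 2) => (x 0, x 1))
      = ((multivariateGaussian 0 S).map fun x : EuclideanSpace ℝ (Fin 2) => x 0).prod
        ((multivariateGaussian 0 S).map fun x : EuclideanSpace ℝ (Fin 2) => x 1) := by
  have hG : HasGaussianLaw (fun x : EuclideanSpace ℝ (Fin 2) => (x 0, x 1))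
      (multivariateGaussian 0 S) :=
    (IsGaussian.hasGaussianLaw_id (μ := multivariateGaussian 0 S)).map
      ((EuclideanSpace.proj (𝕜 := ℝ) (0 : Fin 2)).prod (EuclideanSpace.proj (1 : Fin 2)))
  have hI := hG.indepFun_of_covariance_eq_zero (by
    rw [covariance_eval_multivariateGaussian hS, h])
  exact (indepFun_iff_map_prod_eq_prod_map_map (by fun_prop) (by fun_prop)).1 hI

/-- With centring `√n * α_ii`, the pair is the coordinate image of the convergent vector, and a
Gaussian limit with zero cross covariance is the product of its marginals. -/
lemma asymptoticallyIndependent_alphaHat [IsProbabilityMeasure P]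
    (hX : IsStationaryGaussian X C P)
    (hA2 : CondA2 p C) (hA3 : CondA3 p β₁₁ β₂₂ β₁₂ C) (hβ₁₁ : 1 / 2 < β₁₁) (hβ₂₂ : 1 / 2 < β₂₂)
    {L : Fin 2 → Fin m → ℝ} (hL : IsWeight L) (hlt : (p.α₁₁ + p.α₂₂) / 2 < p.α₁₂) :
    AsymptoticallyIndependent
      (fun (n : ℕ) (ω : Ω) => √(n : ℝ) * alphaHat p L X 0 n ω)
      (fun (n : ℕ) (ω : Ω) => √(n : ℝ) * alphaHat p L X 1 n ω) P := by
  set G := multivariateGaussian 0 (limitCov p L) with hG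
  have hmap := map_coords_multivariateGaussian (posSemidef_limitCov hX hA2 hA3 L)
    (limitCov_cross_eq_zero hlt L)
  have hm : ∀ i : Fin 2, AEMeasurable (fun x : EuclideanSpace ℝ (Fin 2) => x i) G := fun i => by
    fun_prop
  have hg : Continuous fun x : EuclideanSpace ℝ (Fin 2) => (x 0, x 1) := by fun_prop
  have h := (tendstoInDistribution_alphaHat hX hA2 hA3 hβ₁₁ hβ₂₂ hL).continuous_comp hg
  obtain ⟨ν, hν⟩ : ∃ ν : Fin 2 → ProbabilityMeasure ℝ,
      ∀ i, (ν i : Measure ℝ) = G.map fun x : EuclideanSpace ℝ (Fin 2) => x i :=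
    ⟨fun i => ⟨_, Measure.isProbabilityMeasure_map (hm i)⟩, fun i => rfl⟩
  refine ⟨fun n => √(n : ℝ) * p.α₁₁, fun n => √(n : ℝ) * p.α₂₂,
    ν 0, ν 1, ?_⟩
  have hfun : (fun (n : ℕ) (ω : Ω) => (√(n : ℝ) * alphaHat p L X 0 n ω - √(n : ℝ) * p.α₁₁,
        √(n : ℝ) * alphaHat p L X 1 n ω - √(n : ℝ) * p.α₂₂))
      = fun (n : ℕ) => (fun x : EuclideanSpace ℝ (Fin 2) => (x 0, x 1)) ∘
        fun ω => !₂[√(n : ℝ) * (alphaHat p L X 0 n ω - p.α₁₁),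
          √(n : ℝ) * (alphaHat p L X 1 n ω - p.α₂₂)] := by
    ext n ω <;> simp [mul_sub]
  rw [hfun]
  refine ⟨h.forall_aemeasurable, aemeasurable_id, ?_⟩
  convert! h.tendsto using 2
  refine congrArg 𝓝 (Subtype.ext ?_)
  simp only [Measure.map_id, Function.comp_id, hν]
  exact hmap.symm

end Estimator

end BivariateFractal

theorem theorem5 {Ω : Type*} [MeasurableSpace Ω] (P : Measure Ω) [IsProbabilityMeasure P]
    (X : Fin 2 → ℝ → Ω → ℝ) (C : Fin 2 → Fin 2 → ℝ → ℝ)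
    (hX : BivariateFractal.IsStationaryGaussian X C P)
    (p : BivariateFractal.Params) (β₁₁ β₂₂ β₁₂ : ℝ)
    (hA2 : BivariateFractal.CondA2 p C)
    (hA3 : BivariateFractal.CondA3 p β₁₁ β₂₂ β₁₂ C)
    (hβ₁₁ : 1 / 2 < β₁₁) (hβ₂₂ : 1 / 2 < β₂₂)
    (m : ℕ) (hm : 2 ≤ m) (L : Fin 2 → Fin m → ℝ) (hL : BivariateFractal.IsWeight L) :
    (∀ (i j : Fin 2) (u v : Fin m), Summable fun h : ℤ =>
      (BivariateFractal.sigma0 p i j (BivariateFractal.dilation u)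
        (BivariateFractal.dilation v) h) ^ 2) ∧
    (BivariateFractal.limitCov p L).PosSemidef ∧
    TendstoInDistribution
      (fun (n : ℕ) (ω : Ω) =>
        !₂[√(n : ℝ) * (BivariateFractal.alphaHat p L X 0 n ω - p.α₁₁),
           √(n : ℝ) * (BivariateFractal.alphaHat p L X 1 n ω - p.α₂₂)])
      atTop (id : EuclideanSpace ℝ (Fin 2) → EuclideanSpace ℝ (Fin 2)) (fun _ => P)
      (multivariateGaussian 0 (BivariateFractal.limitCov p L)) ∧
    ((p.α₁₁ + p.α₂₂) / 2 < p.α₁₂ →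
      BivariateFractal.AsymptoticallyIndependent
        (fun (n : ℕ) (ω : Ω) => √(n : ℝ) * BivariateFractal.alphaHat p L X 0 n ω)
        (fun (n : ℕ) (ω : Ω) => √(n : ℝ) * BivariateFractal.alphaHat p L X 1 n ω) P) := by
  refine ⟨fun i j u v => BivariateFractal.summable_sigma0_sq hX hA2 hA3 (i, u) (j, v),
    BivariateFractal.posSemidef_limitCov hX hA2 hA3 L,
    BivariateFractal.tendstoInDistribution_alphaHat hX hA2 hA3 hβ₁₁ hβ₂₂ hL,
    BivariateFractal.asymptoticallyIndependent_alphaHat hX hA2 hA3 hβ₁₁ hβ₂₂ hL⟩
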